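/- Let $V$ be a finite-dimensional complex vector space, $\mathcal A$ a finite set of nonzero linear subspaces of $V$, and $X$ the set of all sums of nonempty subfamilies of $\mathcal A$, ordered by inclusion. Let $P=\mathbb Q[c_A : A\in X]$, let $\Lambda$ be the exterior algebra over $\mathbb Q$ with generators $e_A$, $A\in X$, and grade $P\otimes\Lambda$ by $\deg c_A=2$, $\deg e_A=1$. Let $J\subseteq P\otimes\Lambda$ be the two-sided (homogeneous) ideal generated by all elements $$\prod_{A\in X_1}e_A\ \prod_{A\in X_2}c_A\ \Bigl(\sum_{C\in X,\ C\supseteq B}c_C\Bigr)^{d},\qquad d=\dim B-\dim\sum_{A\in X_1\cup X_2}A,$$ where $B\in X$ and $X_1,X_2\subseteq X$ are such that every $A\in X_1\cup X_2$ is strictly contained in $B$ (the first product is taken in any linear order on $X_1$; it matters only up to sign). Put $M=(P\otimes\Lambda)/J$, let $M_r$ be its component of degree $r$, and for $A\in X$ let $$\sigma_A=\sum_{B\in X,\ B\supseteq A}c_B,\qquad \tau_A=\sum_{B\in X,\ B\supseteq A}e_B\qquad\text{in } M .$$ Fix an integer $r\ge 0$. Consider all triples $(S,T,m)$ where $S,T\subseteq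 X$, the set $S\cup T$ is a flag (totally ordered by inclusion), and $m:S\to\mathbb Z_{>0}$ satisfies $m(A)<\dim A-\dim A'$ for every $A\in S$ and $|T|+2\sum_{A\in S}m(A)=r$; here $A'$ is the predecessor of $A$ in $S\cup T$, and $A'=0$ if $A$ is the smallest element of $S\cup T$. Then the monomials $$\mu(S,T,m)=\prod_{B\in T}\tau_B\ \prod_{A\in S}\sigma_A^{m(A)},$$ with the first product taken in increasing order of inclusion, are pairwise distinct for distinct triples and form a basis of the $\mathbb Q$-vector space $M_r$. -/

import Mathlib

open scoped TensorProduct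

noncomputable section

namespace SubspaceModel

variable {V : Type*} [AddCommGroup V] [Module ℂ V]

open scoped Classical in
/-- The set of all sums of nonempty subfamilies of a finite set `𝒜` of subspaces. As a type it is
ordered by inclusion. -/
def sums (𝒜 : Finset (Submodule ℂ V)) : Finset (Submodule ℂ V) :=
  (𝒜.powerset.filter Finset.Nonempty).image fun F => F.sup id

/-- The polynomial algebra over `ℚ` with an indeterminate for each `A ∈ X`. -/
abbrev Poly (X : Finset (Submodule ℂ V)) : Type _ := MvPolynomial X ℚ

/-- The exterior algebra over `ℚ` with a generator for each `A ∈ X`. -/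
abbrev Ext (X : Finset (Submodule ℂ V)) : Type _ := ExteriorAlgebra ℚ (X →₀ ℚ)

/-- The exterior generator of `A`. -/
def extGen {X : Finset (Submodule ℂ V)} (A : X) : Ext X :=
  ExteriorAlgebra.ι ℚ (Finsupp.single A 1)

open scoped Classical in
/-- The number `d(Y, B) = dim B - dim (∑_{A ∈ Y} A)`. -/
def defect {X : Finset (Submodule ℂ V)} (Y : Finset X) (B : X) : ℕ :=
  Module.finrank ℂ (B : Submodule ℂ V) -
    Module.finrank ℂ (Y.sup fun A => (A : Submodule ℂ V) : Submodule ℂ V)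

open scoped Classical in
/-- The element `∏_{A ∈ X₁} e_A ∏_{A ∈ X₂} c_A (∑_{C ⊇ B} c_C) ^ d(X₁ ∪ X₂, B)` of the tensor product
of the polynomial and the exterior algebra; the linear order on `X₁` is that of a list. -/
def relator {X : Finset (Submodule ℂ V)} (X₁ : List X) (X₂ : Finset X) (B : X) :
    Poly X ⊗[ℚ] Ext X :=
  ((∏ A ∈ X₂, MvPolynomial.X A) *
      (∑ C with B ≤ C, MvPolynomial.X C) ^ defect (X₁.toFinset ∪ X₂) B) ⊗ₜ[ℚ]
    (X₁.map extGen).prod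

/-- All the relators, for `X₁, X₂ ⊆ X` and `B ∈ X` such that `B` strictly contains every element of
`X₁ ∪ X₂`. -/
def relators (X : Finset (Submodule ℂ V)) : Set (Poly X ⊗[ℚ] Ext X) :=
  {x | ∃ (X₁ : List X) (X₂ : Finset X) (B : X), X₁.Nodup ∧ (∀ A ∈ X₁, A < B) ∧
    (∀ A ∈ X₂, A < B) ∧ x = relator X₁ X₂ B}

/-- The two-sided ideal generated by the relators. -/
def modelIdeal (X : Finset (Submodule ℂ V)) : Ideal (Poly X ⊗[ℚ] Ext X) :=
  TwoSidedIdeal.asIdeal (TwoSidedIdeal.span (relators X))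

instance modelIdeal_isTwoSided (X : Finset (Submodule ℂ V)) :
    (modelIdeal X).IsTwoSided := by
  unfold modelIdeal
  infer_instance

/-- The algebra `M(X)`: the quotient of the tensor product by the ideal of the relators. The
polynomial generators have even degree, so the graded tensor product is the ordinary one. -/
abbrev Model (X : Finset (Submodule ℂ V)) : Type _ := (Poly X ⊗[ℚ] Ext X) ⧸ modelIdeal X

/-- The quotient map onto `M(X)`. -/
abbrev toModel (X : Finset (Submodule ℂ V)) : (Poly X ⊗[ℚ] Ext X) →ₐ[ℚ] Model X :=
  Ideal.Quotient.mkₐ ℚ (modelIdeal X)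

/-- The elements of degree `r` of the tensor product, where the polynomial generators have degree
`2` and the exterior generators have degree `1`. -/
def tensorDegree (X : Finset (Submodule ℂ V)) (r : ℕ) : Submodule ℚ (Poly X ⊗[ℚ] Ext X) :=
  ⨆ (i : ℕ) (j : ℕ) (_ : 2 * i + j = r),
    Submodule.map₂ (TensorProduct.mk ℚ (Poly X) (Ext X))
      (MvPolynomial.homogeneousSubmodule X ℚ i) (⋀[ℚ]^j (X →₀ ℚ))

/-- The homogeneous component `M(X)_r`. -/
def modelDegree (X : Finset (Submodule ℂ V)) (r : ℕ) : Submodule ℚ (Model X) :=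
  (tensorDegree X r).map (toModel X).toLinearMap

variable {X : Finset (Submodule ℂ V)}

/-- The image of `c_A` in `M(X)`. -/
def c (A : X) : Model X := toModel X (MvPolynomial.X A ⊗ₜ[ℚ] 1)

/-- The image of `e_A` in `M(X)`. -/
def e (A : X) : Model X := toModel X (1 ⊗ₜ[ℚ] extGen A)

open scoped Classical in
/-- `σ_A = ∑_{B ⊇ A} c_B`. -/
def sigma (A : X) : Model X := ∑ B with A ≤ B, c B

open scoped Classical in
/-- `τ_A = ∑_{B ⊇ A} e_B`. -/
def tau (A : X) : Model X := ∑ B with A ≤ B, e B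

theorem commute_c (A B : X) : Commute (c A) (c B) := by
  unfold c
  refine Commute.map ?_ (toModel X)
  simp [Commute, SemiconjBy, mul_comm]

theorem commute_sigma (A B : X) : Commute (sigma A) (sigma B) :=
  Commute.sum_left _ _ _ fun _ _ => Commute.sum_right _ _ _ fun _ _ => commute_c _ _

/-- The monomial `μ(S, T, m) = ∏_{B ∈ T} τ_B ∏_{A ∈ S} σ_A ^ m(A)`, the first product being taken in
the order of the list `T`. -/
def mu (S : Finset X) (T : List X) (m : S → ℕ) : Model X :=
  (T.map tau).prod *
    Finset.univ.noncommProd (fun A : S => sigma (A : X) ^ m A)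
      fun _ _ _ _ _ => (commute_sigma _ _).pow_pow _ _

open scoped Classical in
/-- For a flag `F` this is the predecessor of `A` in `F`, or `0` if `F` has no element strictly
contained in `A`: the sum of a nonempty finite flag is its largest element. -/
def predecessor (F : Finset X) (A : X) : Submodule ℂ V :=
  (F.filter (· < A)).sup fun B => (B : Submodule ℂ V)

open scoped Classical in
/-- The triples `(S, T, m)` that index the basic monomials of degree `r`. The set `T`, ordered by
inclusion, is given as a strictly increasing list; the exponents are positive, so that the elements
of `S` are those whose `σ` occurs in the monomial. -/
structure BasicIndex (X : Finset (Submodule ℂ V)) (r : ℕ) where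
  S : Finset X
  T : List X
  m : S → ℕ
  sorted : T.Pairwise (· < ·)
  flag : IsChain (· ≤ ·) ((S ∪ T.toFinset : Finset X) : Set X)
  m_pos : ∀ A, 0 < m A
  m_lt : ∀ A : S, m A < Module.finrank ℂ ((A : X) : Submodule ℂ V) -
    Module.finrank ℂ (predecessor (S ∪ T.toFinset) (A : X))
  degree : T.length + 2 * ∑ A, m A = r

end SubspaceModel

end

/-!
The relations of `M(X)` are equivalent to relations between the `σ_A` and `τ_A`: on a flag the
products `σ_B ^ d` with prescribed smaller factors vanish, and the product of two generators at
incomparable `A`, `B` can be rewritten through generators at `A + B`. Hence a monomial in the `σ_A`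
and `τ_A` that is not of the form `μ(S, T, m)` is a combination of monomials of the same degree with
larger total dimension, and this total is bounded; so the `μ(S, T, m)` span.

For their independence, fix a flag `F`. Consider the linear form on the polynomials in the `σ_A`
whose value at a monomial is `1` or `0` according to whether, on each level of `F`, its factors
satisfy Postnikov's dragon marriage condition and are as many as this condition permits. Together
with the top coefficient on an exterior algebra for the `τ_A` it respects the relations, because the
dimension is submodular. The values of these forms at products of the `μ(S, T, m)` with
complementary monomials make a matrix that is triangular with respect to the total dimension, with
nonzero diagonal.
-/

open scoped TensorProduct

noncomputable section

namespace SubspaceModel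

open Module

section Dragon

variable {L : Type*} [SemilatticeSup L] [OrderBot L] {f : L → ℕ} {w : Multiset L} {A B C : L}
  {k : ℕ}

/-- Postnikov's dragon marriage condition for the rank function `f`: the join of every nonempty
subfamily `I` of `w` has rank, relative to `⊥`, greater than the size of `I`. -/
def Dragon (f : L → ℕ) (w : Multiset L) : Prop :=
  ∀ I ≤ w, I ≠ 0 → f ⊥ + I.card < f I.sup

theorem Dragon.mono {v : Multiset L} (h : Dragon f w) (hvw : v ≤ w) : Dragon f v :=
  fun I hI => h I (hI.trans hvw)

theorem dragon_cons : Dragon f (A ::ₘ w) ↔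
    Dragon f w ∧ ∀ I ≤ w, f ⊥ + I.card + 1 < f (A ⊔ I.sup) := by
  refine ⟨fun h => ⟨h.mono (Multiset.le_cons_self _ _), fun I hI => ?_⟩, ?_⟩
  · simpa [← add_assoc] using h (A ::ₘ I) (Multiset.cons_le_cons A hI) Multiset.cons_ne_zero
  · rintro ⟨hw, hA⟩ I hI hI0
    by_cases hAI : A ∈ I
    · obtain ⟨I, rfl⟩ := Multiset.exists_cons_of_mem hAI
      simpa [← add_assoc] using hA I ((Multiset.cons_le_cons_iff A).1 hI)
    · exact hw I ((Multiset.le_cons_of_notMem hAI).1 hI) hI0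

theorem Dragon.add_card_le (h : Dragon f w) : f ⊥ + w.card ≤ f w.sup := by
  rcases eq_or_ne w 0 with rfl | hw
  · simp
  · exact (h w le_rfl hw).le

theorem sup_replicate (hk : k ≠ 0) (B : L) : (Multiset.replicate k B).sup = B :=
  le_antisymm (Multiset.sup_le.2 fun _ hb => (Multiset.eq_of_mem_replicate hb).le)
    (Multiset.le_sup (Multiset.mem_replicate.2 ⟨hk, rfl⟩))

theorem dragon_replicate (hk : f ⊥ + k < f B) : Dragon f (Multiset.replicate k B) := by
  intro I hI hI0
  obtain ⟨j, hj, rfl⟩ := Multiset.le_replicate_iff.1 hI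
  have hj0 : j ≠ 0 := by
    rintro rfl
    exact hI0 rfl
  rw [sup_replicate hj0, Multiset.card_replicate]
  omega

theorem Dragon.lt_of_replicate (hk : k ≠ 0) (h : Dragon f (Multiset.replicate k B)) :
    f ⊥ + k < f B := by
  have hne : Multiset.replicate k B ≠ 0 := by
    rwa [ne_eq, ← Multiset.card_eq_zero, Multiset.card_replicate]
  simpa [sup_replicate hk] using h _ le_rfl hne

theorem Dragon.cons_of_le (hAB : ∀ S, f (A ⊔ S) ≤ f (B ⊔ S)) (h : Dragon f (A ::ₘ w)) :
    Dragon f (B ::ₘ w) := by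
  rw [dragon_cons] at h ⊢
  exact ⟨h.1, fun I hI => (h.2 I hI).trans_le (hAB _)⟩

theorem dragon_cons_congr (hAB : ∀ S, f (A ⊔ S) = f (B ⊔ S)) :
    Dragon f (A ::ₘ w) ↔ Dragon f (B ::ₘ w) :=
  ⟨.cons_of_le fun S => (hAB S).le, .cons_of_le fun S => (hAB S).ge⟩

theorem dragon_cons_cons_iff (hf : Monotone f) {J : L} (hJ : Dragon f (J ::ₘ J ::ₘ w))
    (hBC : J ≤ B ⊔ C) :
    Dragon f (B ::ₘ C ::ₘ w) ↔ Dragon f (B ::ₘ w) ∧ Dragon f (C ::ₘ w) := by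
  refine ⟨fun h => ⟨h.mono (Multiset.cons_le_cons _ (Multiset.le_cons_self _ _)),
    h.mono (Multiset.le_cons_self _ _)⟩, fun ⟨hB, hC⟩ => dragon_cons.2 ⟨hC, fun I hI => ?_⟩⟩
  by_cases hCI : C ∈ I
  · obtain ⟨I, rfl⟩ := Multiset.exists_cons_of_mem hCI
    have hIw : J ::ₘ I ≤ J ::ₘ w :=
      Multiset.cons_le_cons _ ((Multiset.cons_le_cons_iff C).1 hI)
    calc f ⊥ + (C ::ₘ I).card + 1 = f ⊥ + (J ::ₘ I).card + 1 := by simp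
      _ < f (J ⊔ (J ::ₘ I).sup) := (dragon_cons.1 hJ).2 _ hIw
      _ ≤ f (B ⊔ (C ::ₘ I).sup) := hf (by
        rw [Multiset.sup_cons, Multiset.sup_cons, ← sup_assoc, ← sup_assoc, sup_idem]
        exact sup_le_sup_right hBC _)
  · exact (dragon_cons.1 hB).2 I ((Multiset.le_cons_of_notMem hCI).1 hI)

end Dragon

section SubmodularRank

variable {L : Type*} [Lattice L] {f : L → ℕ} {w : Multiset L} {A B C : L} {k : ℕ}
  (hf : Monotone f) (hsub : ∀ a b, f (a ⊔ b) + f (a ⊓ b) ≤ f a + f b)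
include hf hsub

theorem rank_sup_add_le (hAB : A ≤ B) (S : L) : f (B ⊔ S) + f A ≤ f (A ⊔ S) + f B := by
  have h := hsub (A ⊔ S) B
  rw [sup_right_comm, sup_eq_right.2 hAB] at h
  have hA : f A ≤ f ((A ⊔ S) ⊓ B) := hf (le_inf le_sup_left hAB)
  omega

variable [OrderBot L]

theorem Dragon.replace_cons (hAB : A ≤ B) (hk : f B ≤ f A + k)
    (h : Dragon f (B ::ₘ (Multiset.replicate k B + w))) :
    Dragon f (A ::ₘ (Multiset.replicate k B + w)) := by
  classical
  rw [dragon_cons] at h ⊢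
  refine ⟨h.1, fun I hI => ?_⟩
  by_cases hBI : B ∈ I
  · have hB := Multiset.le_sup hBI
    rw [sup_eq_right.2 (hAB.trans hB), ← sup_eq_right.2 hB]
    exact h.2 I hI
  · -- Adding `k` copies of `B` to `I` raises the rank by at most `k`.
    have hIw : I ≤ w := Multiset.le_iff_count.2 fun C => by
      by_cases hC : C = B
      · simp [hC, Multiset.count_eq_zero_of_notMem hBI]
      · simpa [Multiset.count_replicate, Ne.symm hC] using Multiset.le_iff_count.1 hI C
    have hB := h.2 (Multiset.replicate k B + I) (by gcongr)
    have hrep : (Multiset.replicate k B).sup ≤ B :=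
      Multiset.sup_le.2 fun _ hb => (Multiset.eq_of_mem_replicate hb).le
    rw [Multiset.sup_add, ← sup_assoc, sup_eq_left.2 hrep, Multiset.card_add,
      Multiset.card_replicate] at hB
    have := rank_sup_add_le hf hsub hAB I.sup
    omega

theorem Dragon.cons_or_cons (h : Dragon f ((A ⊔ C) ::ₘ (A ⊔ C) ::ₘ w)) :
    Dragon f (A ::ₘ w) ∨ Dragon f (C ::ₘ w) := by
  classical
  simp only [dragon_cons (w := _ ::ₘ w), dragon_cons (w := w)] at h ⊢
  obtain ⟨⟨hw, -⟩, hJ⟩ := h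
  by_contra! ⟨hA, hC⟩
  -- Obstructions `I` and `K` to both alternatives would make `I ∪ K` one to the hypothesis.
  obtain ⟨I, hI, hAI⟩ := hA hw
  obtain ⟨K, hK, hCK⟩ := hC hw
  have hunion := hJ ((A ⊔ C) ::ₘ (I ∪ K)) (Multiset.cons_le_cons _ (Multiset.union_le hI hK))
  have hinter := (hw.mono (Multiset.inter_le_left.trans hI) : Dragon f (I ∩ K)).add_card_le
  have hcard : (I ∪ K).card + (I ∩ K).card = I.card + K.card := by
    rw [← Multiset.card_add, Multiset.union_add_inter, Multiset.card_add]
  have hinf : f (I ∩ K).sup ≤ f ((A ⊔ I.sup) ⊓ (C ⊔ K.sup)) := hf <| le_inf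
    (le_sup_of_le_right (Multiset.sup_mono (Multiset.subset_of_le Multiset.inter_le_left)))
    (le_sup_of_le_right (Multiset.sup_mono (Multiset.subset_of_le Multiset.inter_le_right)))
  have hsup := hsub (A ⊔ I.sup) (C ⊔ K.sup)
  rw [Multiset.sup_cons, ← sup_assoc, sup_idem, Multiset.sup_union, sup_sup_sup_comm,
    Multiset.card_cons] at hunion
  omega

open scoped Classical in
theorem dragon_exchange (R : Type*) [Ring R] {J : L} (hJ : J = A ⊔ C) :
    (if Dragon f (A ::ₘ C ::ₘ w) then 1 else 0 : R) - (if Dragon f (A ::ₘ J ::ₘ w) then 1 else 0)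
      - (if Dragon f (J ::ₘ C ::ₘ w) then 1 else 0)
      + (if Dragon f (J ::ₘ J ::ₘ w) then 1 else 0) = 0 := by
  subst hJ
  have hA : ∀ S, f (A ⊔ S) ≤ f (A ⊔ C ⊔ S) := fun S => hf (sup_le_sup_right le_sup_left S)
  have hC : ∀ S, f (C ⊔ S) ≤ f (A ⊔ C ⊔ S) := fun S => hf (sup_le_sup_right le_sup_right S)
  by_cases hJJ : Dragon f ((A ⊔ C) ::ₘ (A ⊔ C) ::ₘ w)
  · -- Each term is a product of indicators, so the sum is `(1_A - 1_J) * (1_C - 1_J)`.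
    have hJ : Dragon f ((A ⊔ C) ::ₘ w) := hJJ.mono (Multiset.le_cons_self _ _)
    simp only [dragon_cons_cons_iff hf hJJ le_rfl, dragon_cons_cons_iff hf hJJ le_sup_right,
      dragon_cons_cons_iff hf hJJ le_sup_left, hJ]
    rcases hJJ.cons_or_cons hf hsub with h | h <;> simp [h]
  · have hAJ : ¬ Dragon f (A ::ₘ (A ⊔ C) ::ₘ w) := fun h => hJJ (h.cons_of_le hA)
    have hJC : ¬ Dragon f ((A ⊔ C) ::ₘ C ::ₘ w) := fun h =>
      hJJ (.cons_of_le hC (Multiset.cons_swap _ _ _ ▸ h))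
    have hAC : ¬ Dragon f (A ::ₘ C ::ₘ w) := fun h => hJC (h.cons_of_le hA)
    simp [hJJ, hAJ, hJC, hAC]

end SubmodularRank

section UpperSum

variable {P : Type*} [Fintype P]

section PartialOrder

variable [PartialOrder P] {M : Type*} [AddCommGroup M]

open scoped Classical in
/-- The sum of the values of `g` at all elements above `A`; thus `σ` and `τ` are the upper sums of
`c` and `e`. -/
def upperSum (g : P → M) (A : P) : M := ∑ B with A ≤ B, g B

theorem map_upperSum {N Φ : Type*} [AddCommGroup N] [FunLike Φ M N] [AddMonoidHomClass Φ M N]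
    (φ : Φ) (g : P → M) (A : P) : φ (upperSum g A) = upperSum (fun B => φ (g B)) A :=
  map_sum φ _ _

open scoped Classical in
theorem upperSum_eq_add_sum_lt (g : P → M) (A : P) :
    upperSum g A = g A + ∑ B with A < B, g B := by
  have hfilter : Finset.univ.filter (A ≤ ·) = insert A (Finset.univ.filter (A < ·)) := by
    ext B
    simp [le_iff_eq_or_lt, eq_comm]
  rw [upperSum, hfilter, Finset.sum_insert (by simp)]

open scoped Classical in
theorem upperSum_sub_upperSum (g : P → M) {A J : P} (h : A ≤ J) :
    upperSum g A - upperSum g J = ∑ B with A ≤ B ∧ ¬ J ≤ B, g B := by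
  rw [upperSum, upperSum, Finset.filter_and_not,
    Finset.sum_sdiff_eq_sub (Finset.monotone_filter_right _ fun _ _ => h.trans)]

theorem map_upperSum_sub_upperSum {N : Type*} [AddCommGroup N] (φ : M →+ N) {g : P → M} {A J : P}
    (hAJ : A < J) (hφ : ∀ B, A < B → ¬ J ≤ B → φ (g B) = 0) :
    φ (upperSum g A - upperSum g J) = φ (g A) := by
  classical
  rw [upperSum_sub_upperSum g hAJ.le, map_sum]
  refine Finset.sum_eq_single_of_mem A (by simp [hAJ.not_ge]) fun B hB hBA => ?_
  obtain ⟨-, hAB, hJB⟩ := Finset.mem_filter.1 hB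
  exact hφ B (lt_of_le_of_ne hAB hBA.symm) hJB

theorem exists_upperSum_eq (f : P → M) : ∃ g : P → M, upperSum g = f := by
  classical
  let g : P → M := wellFounded_gt.fix fun A ih => f A - ∑ B : {B // A < B}, ih B.1 B.2
  have hg : ∀ A, g A = f A - ∑ B : {B // A < B}, g B := wellFounded_gt.fix_eq _
  refine ⟨g, funext fun A => ?_⟩
  rw [upperSum_eq_add_sum_lt, hg A, Finset.sum_subtype (p := (A < ·)) _ (by simp) g, sub_add_cancel]

theorem span_range_upperSum (k : Type*) [Ring k] [Module k M] (g : P → M) :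
    Submodule.span k (Set.range (upperSum g)) = Submodule.span k (Set.range g) := by
  classical
  apply le_antisymm <;> rw [Submodule.span_le] <;> rintro _ ⟨A, rfl⟩
  · exact Submodule.sum_mem _ fun B _ => Submodule.subset_span ⟨B, rfl⟩
  · induction A using WellFoundedGT.induction with
    | ind A ih =>
      rw [← add_sub_cancel_right (g A) (∑ B with A < B, g B), ← upperSum_eq_add_sum_lt]
      exact Submodule.sub_mem _ (Submodule.subset_span ⟨A, rfl⟩)
        (Submodule.sum_mem _ fun B hB => ih B (Finset.mem_filter.1 hB).2)

end PartialOrder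

section SemilatticeSup

variable [SemilatticeSup P] {R : Type*} [Ring R] {u w : P → R}

theorem mul_upperSum_sub_eq_zero_iff {z : R} {A : P} :
    (∀ B, ¬ B ≤ A → z * (upperSum w B - upperSum w (A ⊔ B)) = 0) ↔
      ∀ B, IncompRel (· ≤ ·) A B → z * w B = 0 := by
  classical
  constructor
  · intro hz B
    induction B using WellFoundedGT.induction with
    | ind B ih =>
      rintro ⟨hAB, hBA⟩
      rw [← hz B hBA]
      refine (map_upperSum_sub_upperSum (AddMonoidHom.mulLeft z) (right_lt_sup.2 hAB)
        fun E hBE hE => ih E hBE ⟨fun hAE => hE (sup_le hAE hBE.le), ?_⟩).symm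
      exact fun hEA => hBA (hBE.le.trans hEA)
  · intro hz B hBA
    rw [upperSum_sub_upperSum w le_sup_right, Finset.mul_sum]
    refine Finset.sum_eq_zero fun E hE => ?_
    obtain ⟨-, hBE, hE⟩ := Finset.mem_filter.1 hE
    exact hz E ⟨fun hAE => hE (sup_le hAE hBE), fun hEA => hBA (hBE.trans hEA)⟩

theorem upperSum_sub_mul_upperSum_sub_eq_zero_iff :
    (∀ A B, (upperSum u A - upperSum u (A ⊔ B)) * (upperSum w B - upperSum w (A ⊔ B)) = 0) ↔
      ∀ A B, IncompRel (· ≤ ·) A B → u A * w B = 0 := by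
  classical
  simp only [← mul_upperSum_sub_eq_zero_iff]
  -- Both `upperSum w B` and `upperSum w (A ⊔ B)` may be exchanged for `upperSum w (E ⊔ B)`.
  have key {A B E : P} (hAE : A ≤ E) (hBE : ¬ B ≤ E)
      (h : ∀ D, ¬ D ≤ E → u E * (upperSum w D - upperSum w (E ⊔ D)) = 0) :
      u E * (upperSum w B - upperSum w (A ⊔ B)) = 0 := by
    have hB := h B hBE
    have hAB := h (A ⊔ B) fun hle => hBE (le_sup_right.trans hle)
    rw [← sup_assoc, sup_eq_left.2 hAE] at hAB
    rw [← sub_sub_sub_cancel_right _ _ (upperSum w (E ⊔ B)), mul_sub, hB, hAB, sub_zero]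
  constructor
  · intro h A
    induction A using WellFoundedGT.induction with
    | ind A ih =>
      intro B hBA
      rw [← h A B]
      exact (map_upperSum_sub_upperSum
        (AddMonoidHom.mulRight (upperSum w B - upperSum w (A ⊔ B))) (left_lt_sup.2 hBA)
        fun E hAE hE => key hAE.le (fun hBE => hE (sup_le hAE.le hBE)) (ih E hAE)).symm
  · intro h A B
    rw [upperSum_sub_upperSum u le_sup_left, Finset.sum_mul]
    refine Finset.sum_eq_zero fun E hE => ?_
    obtain ⟨-, hAE, hE⟩ := Finset.mem_filter.1 hE
    exact key hAE (fun hBE => hE (sup_le hAE hBE)) (h E)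

theorem mul_pow_eq_mul_pow {z x y : R} (hxy : Commute x y)
    (h : z * (x - y) = 0) (k : ℕ) : z * x ^ k = z * y ^ k := by
  rw [← sub_eq_zero, ← mul_sub, ← hxy.mul_geom_sum₂, ← mul_assoc, h, zero_mul]

theorem upperSum_sub_mul_upperSum_pow_eq_zero_iff {rk : P → ℕ}
    (hrk : ∀ A B E, A ≤ B → rk (E ⊔ B) + rk A ≤ rk (E ⊔ A) + rk B)
    (hw : ∀ A B, Commute (w A) (w B)) (huw : ∀ A B, IncompRel (· ≤ ·) A B → u A * w B = 0) :
    (∀ A B, A < B → (upperSum u A - upperSum u B) * upperSum w B ^ (rk B - rk A) = 0) ↔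
      ∀ A B, A < B → u A * upperSum w B ^ (rk B - rk A) = 0 := by
  classical
  have key {A B E : P} (hAB : A < B) (hAE : A ≤ E) (hBE : ¬ B ≤ E)
      (h : ∀ D, E < D → u E * upperSum w D ^ (rk D - rk E) = 0) :
      u E * upperSum w B ^ (rk B - rk A) = 0 := by
    have hcomm : Commute (upperSum w B) (upperSum w (E ⊔ B)) :=
      Commute.sum_left _ _ _ fun _ _ => Commute.sum_right _ _ _ fun _ _ => hw _ _
    have hle : rk (E ⊔ B) - rk E ≤ rk B - rk A := by
      have hrank := hrk A B E hAB.le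
      rw [sup_eq_left.2 hAE] at hrank
      omega
    rw [mul_pow_eq_mul_pow hcomm (mul_upperSum_sub_eq_zero_iff.2 (huw E) B hBE),
      ← Nat.add_sub_cancel' hle, pow_add, ← mul_assoc, h _ (left_lt_sup.2 hBE), zero_mul]
  constructor
  · intro h A
    induction A using WellFoundedGT.induction with
    | ind A ih =>
      intro B hAB
      rw [← h A B hAB]
      exact (map_upperSum_sub_upperSum (AddMonoidHom.mulRight (upperSum w B ^ (rk B - rk A))) hAB
        fun E hAE hBE => key hAB hAE.le hBE (ih E hAE)).symm
  · intro h A B hAB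
    rw [upperSum_sub_upperSum u hAB.le, Finset.sum_mul]
    refine Finset.sum_eq_zero fun E hE => ?_
    obtain ⟨-, hAE, hBE⟩ := Finset.mem_filter.1 hE
    exact key hAB hAE hBE (h E)

end SemilatticeSup

end UpperSum

section Rank

variable {V : Type*} [AddCommGroup V] [Module ℂ V]

/-- The rank function whose dragon marriage condition enters at a level of a flag: the dimension of
the sum with a fixed subspace `p`. -/
def relRank (p S : Submodule ℂ V) : ℕ := finrank ℂ (p ⊔ S : Submodule ℂ V)

theorem relRank_bot (p : Submodule ℂ V) : relRank p ⊥ = finrank ℂ p := by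
  rw [relRank, sup_bot_eq]

variable [FiniteDimensional ℂ V]

theorem relRank_mono (p : Submodule ℂ V) : Monotone (relRank p) :=
  fun _ _ h => Submodule.finrank_mono (sup_le_sup_left h p)

theorem relRank_sup_add_inf_le (p A B : Submodule ℂ V) :
    relRank p (A ⊔ B) + relRank p (A ⊓ B) ≤ relRank p A + relRank p B := by
  have h := Submodule.finrank_sup_add_finrank_inf_eq (p ⊔ A) (p ⊔ B)
  rw [← sup_sup_distrib_left] at h
  have hinf : relRank p (A ⊓ B) ≤ finrank ℂ ((p ⊔ A) ⊓ (p ⊔ B) : Submodule ℂ V) :=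
    Submodule.finrank_mono sup_inf_le
  unfold relRank at *
  omega

theorem finrank_sup_add_le {A B : Submodule ℂ V} (h : A ≤ B) (q : Submodule ℂ V) :
    finrank ℂ (q ⊔ B : Submodule ℂ V) + finrank ℂ A ≤
      finrank ℂ (q ⊔ A : Submodule ℂ V) + finrank ℂ B := by
  rw [sup_comm q, sup_comm q]
  exact rank_sup_add_le (f := fun S : Submodule ℂ V => finrank ℂ S)
    (fun _ _ h => Submodule.finrank_mono h)
    (fun A B => (Submodule.finrank_sup_add_finrank_inf_eq A B).le) h q

end Rank

section Flag

variable {V : Type*} [AddCommGroup V] [Module ℂ V] {X : Finset (Submodule ℂ V)} {F : Finset X}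

theorem le_predecessor {A B : X} (hB : B ∈ F) (h : B < A) :
    (B : Submodule ℂ V) ≤ predecessor F A := by
  classical
  exact Finset.le_sup (f := fun B : X => (B : Submodule ℂ V)) (Finset.mem_filter.2 ⟨hB, h⟩)

theorem exists_sup_eq_of_isChain {G : Finset X} (hG : IsChain (· ≤ ·) (G : Set X))
    (h : G.Nonempty) : ∃ B ∈ G, (G.sup fun B => (B : Submodule ℂ V)) = B := by
  obtain ⟨B, hB⟩ := G.exists_maximal h
  refine ⟨B, hB.1, le_antisymm (Finset.sup_le fun C hC => ?_)
    (Finset.le_sup (f := fun B : X => (B : Submodule ℂ V)) hB.1)⟩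
  exact (hG.total hC hB.1).elim id fun h => hB.2 hC h

theorem predecessor_cases (hF : IsChain (· ≤ ·) (F : Set X)) (A : X) :
    predecessor F A = ⊥ ∨ ∃ B ∈ F, B < A ∧ predecessor F A = B := by
  classical
  rcases (F.filter (· < A)).eq_empty_or_nonempty with h | h
  · left
    simp [predecessor, h]
  · right
    obtain ⟨B, hB, h⟩ := exists_sup_eq_of_isChain
      (hF.mono (Finset.coe_subset.2 (Finset.filter_subset _ _))) h
    exact ⟨B, (Finset.mem_filter.1 hB).1, (Finset.mem_filter.1 hB).2, h⟩

/-- The subspace `C` is on the level of `A` in the flag `F`: it is contained in `A`, but not in the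
predecessor of `A`. -/
def Level (F : Finset X) (A C : X) : Prop :=
  C ≤ A ∧ ¬ (C : Submodule ℂ V) ≤ predecessor F A

theorem not_le_predecessor (hX : ∀ A ∈ X, A ≠ ⊥) (hF : IsChain (· ≤ ·) (F : Set X)) {A C : X}
    (hC : ∀ B ∈ F, B < A → ¬ C ≤ B) : ¬ (C : Submodule ℂ V) ≤ predecessor F A := by
  rcases predecessor_cases hF A with h | ⟨B, hB, hBA, h⟩
  · rw [h, le_bot_iff]
    exact hX _ C.2
  · rw [h]
    exact hC B hB hBA

theorem level_self (hX : ∀ A ∈ X, A ≠ ⊥) (hF : IsChain (· ≤ ·) (F : Set X)) (A : X) :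
    Level F A A :=
  ⟨le_rfl, not_le_predecessor hX hF fun _ _ hBA => hBA.not_ge⟩

theorem exists_level (hX : ∀ A ∈ X, A ≠ ⊥) (hF : IsChain (· ≤ ·) (F : Set X)) {C : X}
    (h : ∃ A ∈ F, C ≤ A) : ∃ A ∈ F, Level F A C := by
  classical
  have hne : (F.filter (C ≤ ·)).Nonempty := by
    obtain ⟨A, hA, hCA⟩ := h
    exact ⟨A, Finset.mem_filter.2 ⟨hA, hCA⟩⟩
  obtain ⟨A, hA⟩ := (F.filter (C ≤ ·)).exists_minimal hne
  obtain ⟨hAF, hCA⟩ := Finset.mem_filter.1 hA.1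
  exact ⟨A, hAF, hCA, not_le_predecessor hX hF fun B hB hBA hCB =>
    hBA.not_ge (hA.2 (Finset.mem_filter.2 ⟨hB, hCB⟩) hBA.le)⟩

theorem Level.not_lt {A B C : X} (hA : A ∈ F) (hAC : Level F A C) (hBC : Level F B C) :
    ¬ A < B :=
  fun h => hBC.2 (le_trans (Subtype.coe_le_coe.2 hAC.1) (le_predecessor hA h))

theorem Level.unique (hF : IsChain (· ≤ ·) (F : Set X)) {A B C : X} (hA : A ∈ F) (hB : B ∈ F)
    (hAC : Level F A C) (hBC : Level F B C) : A = B := by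
  by_contra hne
  rcases hF.total hA hB with h | h
  · exact hAC.not_lt hA hBC (lt_of_le_of_ne h hne)
  · exact hBC.not_lt hB hAC (lt_of_le_of_ne h (Ne.symm hne))

theorem Level.mono {A B C : X} (h : Level F A B) (hBC : B ≤ C) (hCA : C ≤ A) : Level F A C :=
  ⟨hCA, fun hC => h.2 (le_trans (Subtype.coe_le_coe.2 hBC) hC)⟩

open scoped Classical in
/-- The members of `w` on the level of `A`. -/
def part (F : Finset X) (A : X) (w : Multiset X) : Multiset (Submodule ℂ V) :=
  (w.filter (Level F A)).map (↑)

theorem part_add (A : X) (u w : Multiset X) : part F A (u + w) = part F A u + part F A w := by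
  simp [part]

theorem part_of_level {A : X} {u : Multiset X} (hu : ∀ C ∈ u, Level F A C) :
    part F A u = u.map (↑) := by
  classical
  rw [part, Multiset.filter_eq_self.2 hu]

theorem part_of_level_ne (hF : IsChain (· ≤ ·) (F : Set X)) {A B : X} (hA : A ∈ F) (hB : B ∈ F)
    (hBA : B ≠ A) {u : Multiset X} (hu : ∀ C ∈ u, Level F A C) : part F B u = 0 := by
  classical
  rw [part, Multiset.filter_eq_nil.2 fun C hC h => hBA (h.unique hF hB hA (hu C hC)),
    Multiset.map_zero]

/-- The monomials on which the functional of the flag `F` takes the value `1`: the members on the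
level of each `A ∈ F` satisfy the dragon marriage condition relative to the predecessor of `A`, and
their number is the greatest possible. -/
def Good (F : Finset X) (w : Multiset X) : Prop :=
  (∀ C ∈ w, ∃ A ∈ F, C ≤ A) ∧ ∀ A ∈ F,
    (part F A w).card + finrank ℂ (predecessor F A) + 1 = finrank ℂ (A : Submodule ℂ V) ∧
      Dragon (relRank (predecessor F A)) (part F A w)

theorem exists_good_add_iff (hF : IsChain (· ≤ ·) (F : Set X)) {A : X} (hA : A ∈ F) (k : ℕ)
    (w : Multiset X) : ∃ R : Prop, ∀ u : Multiset X, u.card = k → (∀ C ∈ u, Level F A C) →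
      (Good F (u + w) ↔ R ∧ Dragon (relRank (predecessor F A)) (u.map (↑) + part F A w)) := by
  refine ⟨(∀ C ∈ w, ∃ A ∈ F, C ≤ A) ∧
    k + (part F A w).card + finrank ℂ (predecessor F A) + 1 = finrank ℂ (A : Submodule ℂ V) ∧
    ∀ B ∈ F, B ≠ A →
      (part F B w).card + finrank ℂ (predecessor F B) + 1 = finrank ℂ (B : Submodule ℂ V) ∧
        Dragon (relRank (predecessor F B)) (part F B w), ?_⟩
  rintro u rfl hu
  have hcov : (∀ C ∈ u + w, ∃ A ∈ F, C ≤ A) ↔ ∀ C ∈ w, ∃ A ∈ F, C ≤ A := by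
    simp only [Multiset.mem_add, or_imp, forall_and, and_iff_right_iff_imp]
    exact fun _ C hC => ⟨A, hA, (hu C hC).1⟩
  have hpartA : part F A (u + w) = u.map (↑) + part F A w := by rw [part_add, part_of_level hu]
  have hpart : ∀ B ∈ F, B ≠ A → part F B (u + w) = part F B w := fun B hB hBA => by
    rw [part_add, part_of_level_ne hF hA hB hBA hu, zero_add]
  have hcard : (part F A (u + w)).card = u.card + (part F A w).card := by simp [hpartA]
  rw [Good, hcov, ← hcard, ← hpartA]
  constructor
  · rintro ⟨hw, h⟩
    exact ⟨⟨hw, (h A hA).1, fun B hB hBA => hpart B hB hBA ▸ h B hB⟩, (h A hA).2⟩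
  · rintro ⟨⟨hw, hA₁, h⟩, hA₂⟩
    refine ⟨hw, fun B hB => ?_⟩
    rcases eq_or_ne B A with rfl | hBA
    · exact ⟨hA₁, hA₂⟩
    · exact (hpart B hB hBA).symm ▸ h B hB hBA

end Flag

section FlagRing

variable {V : Type*} [AddCommGroup V] [Module ℂ V] {X : Finset (Submodule ℂ V)} {F : Finset X}

theorem prod_map_X (w : Multiset X) : (w.map (MvPolynomial.X : X → Poly X)).prod =
    MvPolynomial.basisMonomials X ℚ (Multiset.toFinsupp w) := by
  induction w using Multiset.induction_on with
  | empty => simp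
  | cons A w ih =>
    rw [Multiset.map_cons, Multiset.prod_cons, ih, ← Multiset.singleton_add, map_add]
    simp [MvPolynomial.X, MvPolynomial.monomial_mul]

open scoped Classical in
/-- The functional on polynomials in the `σ_A` that sends a monomial to `1` if it is good and to `0`
otherwise. -/
def goodFun (F : Finset X) : Poly X →ₗ[ℚ] ℚ :=
  (MvPolynomial.basisMonomials X ℚ).constr ℚ fun α => if Good F (Finsupp.toMultiset α) then 1 else 0

/-- The largest ideal in the kernel of `goodFun F`. -/
def goodIdeal (F : Finset X) : Ideal (Poly X) where
  carrier := {q | ∀ r, goodFun F (q * r) = 0}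
  add_mem' h₁ h₂ r := by rw [add_mul, map_add, h₁, h₂, add_zero]
  zero_mem' r := by rw [zero_mul, map_zero]
  smul_mem' a q h r := by rw [smul_eq_mul, mul_comm a, mul_assoc, h]

/-- The Gorenstein quotient of the polynomial ring in the `σ_A` in which a product vanishes as soon
as `goodFun F` vanishes on all its multiples. -/
abbrev FlagRing (F : Finset X) : Type _ := Poly X ⧸ goodIdeal F

/-- The image of `σ_A` in `FlagRing F`. -/
def flagSigma (F : Finset X) (A : X) : FlagRing F :=
  Ideal.Quotient.mk (goodIdeal F) (MvPolynomial.X A)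

/-- The image of `c_A` in `FlagRing F`, obtained by solving `σ_A = ∑_{B ⊇ A} c_B`. -/
def flagC (F : Finset X) : X → FlagRing F := (exists_upperSum_eq (flagSigma F)).choose

theorem upperSum_flagC (F : Finset X) : upperSum (flagC F) = flagSigma F :=
  (exists_upperSum_eq (flagSigma F)).choose_spec

/-- The functional induced by `goodFun F` on `FlagRing F`. -/
def flagFun (F : Finset X) : FlagRing F →ₗ[ℚ] ℚ :=
  ((goodIdeal F).restrictScalars ℚ).liftQ (goodFun F) (fun q hq => by simpa using hq 1) ∘ₗ
    (Submodule.Quotient.restrictScalarsEquiv ℚ (goodIdeal F)).symm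

theorem flagFun_mk (q : Poly X) : flagFun F (Ideal.Quotient.mk (goodIdeal F) q) = goodFun F q := rfl

theorem prod_flagSigma (w : Multiset X) : (w.map (flagSigma F)).prod =
    Ideal.Quotient.mk (goodIdeal F) (w.map MvPolynomial.X).prod := by
  rw [map_multiset_prod, Multiset.map_map]
  rfl

open scoped Classical in
theorem flagFun_prod (w : Multiset X) :
    flagFun F (w.map (flagSigma F)).prod = if Good F w then 1 else 0 := by
  rw [prod_flagSigma, flagFun_mk, prod_map_X, goodFun, Basis.constr_basis]
  simp

theorem flagRing_ext {x y : FlagRing F}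
    (h : ∀ w : Multiset X, flagFun F (x * (w.map (flagSigma F)).prod) =
      flagFun F (y * (w.map (flagSigma F)).prod)) : x = y := by
  obtain ⟨p, rfl⟩ := Ideal.Quotient.mk_surjective x
  obtain ⟨q, rfl⟩ := Ideal.Quotient.mk_surjective y
  rw [Ideal.Quotient.eq]
  have hzero : goodFun F ∘ₗ LinearMap.mulLeft ℚ (p - q) = 0 := by
    refine (MvPolynomial.basisMonomials X ℚ).ext fun α => ?_
    have hα := h (Finsupp.toMultiset α)
    rw [prod_flagSigma, ← map_mul, ← map_mul, flagFun_mk, flagFun_mk, prod_map_X,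
      Finsupp.toMultiset_toFinsupp, ← sub_eq_zero, ← map_sub, ← sub_mul] at hα
    exact hα
  exact LinearMap.congr_fun hzero

theorem prod_flagSigma_congr {u v : Multiset X}
    (h : ∀ w, Good F (u + w) ↔ Good F (v + w)) :
    (u.map (flagSigma F)).prod = (v.map (flagSigma F)).prod := by
  classical
  refine flagRing_ext fun w => ?_
  simp only [← Multiset.prod_add, ← Multiset.map_add, flagFun_prod, h w]

theorem prod_flagSigma_eq_zero {u : Multiset X} (h : ∀ w, ¬ Good F (u + w)) :
    (u.map (flagSigma F)).prod = 0 := by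
  classical
  refine flagRing_ext fun w => ?_
  rw [← Multiset.prod_add, ← Multiset.map_add, flagFun_prod, if_neg (h w), zero_mul, map_zero]

theorem flagSigma_eq_zero {C : X} (hC : ¬ ∃ A ∈ F, C ≤ A) : flagSigma F C = 0 := by
  rw [← Multiset.prod_singleton (flagSigma F C), ← Multiset.map_singleton]
  exact prod_flagSigma_eq_zero fun w h =>
    hC (h.1 C (Multiset.mem_add.2 (Or.inl (Multiset.mem_singleton_self C))))

section Level

variable (hF : IsChain (· ≤ ·) (F : Set X)) {A B C D J : X} (hD : D ∈ F) (hB : Level F D B)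
include hF hD hB

theorem flagSigma_eq_of_level (hJ : Level F D J)
    (h : predecessor F D ⊔ (B : Submodule ℂ V) = predecessor F D ⊔ J) :
    flagSigma F B = flagSigma F J := by
  simpa using prod_flagSigma_congr (u := {B}) (v := {J}) fun w => by
    obtain ⟨R, hR⟩ := exists_good_add_iff hF hD 1 w
    rw [hR {B} rfl (by simpa using hB), hR {J} rfl (by simpa using hJ)]
    refine and_congr_right fun _ => ?_
    simp only [Multiset.map_singleton, Multiset.singleton_add]
    exact dragon_cons_congr fun S => by rw [relRank, relRank, ← sup_assoc, ← sup_assoc, h]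

variable [FiniteDimensional ℂ V]

theorem flagSigma_pow_eq_zero_of_level {k : ℕ}
    (hk : relRank (predecessor F D) B ≤ finrank ℂ (predecessor F D) + k) :
    flagSigma F B ^ k = 0 := by
  have hk0 : k ≠ 0 := by
    rintro rfl
    exact hB.2 (left_eq_sup.1 (Submodule.eq_of_le_of_finrank_le le_sup_left hk))
  rw [← Multiset.prod_replicate, ← Multiset.map_replicate]
  refine prod_flagSigma_eq_zero fun w => ?_
  obtain ⟨R, hR⟩ := exists_good_add_iff hF hD k w
  rw [hR _ (Multiset.card_replicate k B) fun C hC => by rwa [Multiset.eq_of_mem_replicate hC],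
    Multiset.map_replicate]
  rintro ⟨-, h⟩
  have := (h.mono (Multiset.le_add_right _ _)).lt_of_replicate hk0
  rw [relRank_bot] at this
  omega

theorem flagSigma_mul_pow_of_level (hA : Level F D A) (hAB : A ≤ B) {k : ℕ}
    (hk : finrank ℂ (B : Submodule ℂ V) ≤ finrank ℂ (A : Submodule ℂ V) + k) :
    flagSigma F A * flagSigma F B ^ k = flagSigma F B * flagSigma F B ^ k := by
  rw [← Multiset.prod_replicate, ← Multiset.map_replicate, ← Multiset.prod_cons,
    ← Multiset.prod_cons, ← Multiset.map_cons, ← Multiset.map_cons]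
  refine prod_flagSigma_congr fun w => ?_
  obtain ⟨R, hR⟩ := exists_good_add_iff hF hD (k + 1) w
  have hlevel : ∀ C, Level F D C → ∀ E ∈ C ::ₘ Multiset.replicate k B, Level F D E := by
    simp +contextual [Multiset.mem_replicate, hB]
  have hrank := finrank_sup_add_le (Subtype.coe_le_coe.2 hAB) (predecessor F D)
  rw [hR _ (by simp) (hlevel A hA), hR _ (by simp) (hlevel B hB)]
  refine and_congr_right fun _ => ?_
  simp only [Multiset.map_cons, Multiset.map_replicate, Multiset.cons_add]
  exact ⟨.cons_of_le fun S => relRank_mono _ (sup_le_sup_right (Subtype.coe_le_coe.2 hAB) S),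
    .replace_cons (relRank_mono _) (relRank_sup_add_inf_le _) hAB (by unfold relRank; omega)⟩

theorem flagSigma_exchange_of_level (hA : Level F D A) (hJD : Level F D J)
    (hJ : (J : Submodule ℂ V) = (A : Submodule ℂ V) ⊔ B) :
    (flagSigma F A - flagSigma F J) * (flagSigma F B - flagSigma F J) = 0 := by
  classical
  refine flagRing_ext fun w => ?_
  obtain ⟨R, hR⟩ := exists_good_add_iff hF hD 2 w
  have key : ∀ B C : X, Level F D B → Level F D C →
      flagFun F (flagSigma F B * flagSigma F C * (w.map (flagSigma F)).prod) =
        if R then (if Dragon (relRank (predecessor F D))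
          ((B : Submodule ℂ V) ::ₘ (C : Submodule ℂ V) ::ₘ part F D w) then 1 else 0) else 0 := by
    intro B C hB hC
    have hprod : flagSigma F B * flagSigma F C * (w.map (flagSigma F)).prod =
        ((({B, C} : Multiset X) + w).map (flagSigma F)).prod := by simp [mul_assoc]
    rw [hprod, flagFun_prod, if_congr (hR {B, C} rfl (by simp [hB, hC])) rfl rfl, ite_and]
    simp
  have hexchange := dragon_exchange (w := part F D w) (relRank_mono (predecessor F D))
    (relRank_sup_add_inf_le _) ℚ hJ
  simp only [sub_mul, mul_sub, map_sub, zero_mul, map_zero, key A B hA hB, key A J hA hJD,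
    key J B hJD hB, key J J hJD hJD]
  by_cases hR : R
  · simp only [if_pos hR]
    linear_combination hexchange
  · simp only [if_neg hR, sub_zero]

end Level

end FlagRing

section FlagRelations

variable {V : Type*} [AddCommGroup V] [Module ℂ V] {X : Finset (Submodule ℂ V)} {F : Finset X}

/-- The semilattice structure of a family of subspaces that is closed under sums. -/
abbrev supSemilattice (hsup : SupClosed (X : Set (Submodule ℂ V))) : SemilatticeSup X :=
  Subtype.semilatticeSup fun _ _ hA hB => hsup hA hB

theorem le_of_coe_eq_sup {A B J : X} (hJ : (J : Submodule ℂ V) = (A : Submodule ℂ V) ⊔ B) :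
    A ≤ J ∧ B ≤ J :=
  ⟨Subtype.coe_le_coe.1 (hJ ▸ le_sup_left), Subtype.coe_le_coe.1 (hJ ▸ le_sup_right)⟩

theorem flagSigma_mul_eq_zero (hF : IsChain (· ≤ ·) (F : Set X)) {A B J : X}
    (hJ : (J : Submodule ℂ V) = (A : Submodule ℂ V) ⊔ B) (hcov : ¬ ∃ D ∈ F, J ≤ D) :
    flagSigma F A * flagSigma F B = 0 := by
  by_cases hA : ∃ D ∈ F, A ≤ D
  · by_cases hB : ∃ E ∈ F, B ≤ E
    · obtain ⟨D, hD, hAD⟩ := hA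
      obtain ⟨E, hE, hBE⟩ := hB
      refine absurd ?_ hcov
      simp only [← Subtype.coe_le_coe, hJ]
      rcases hF.total hD hE with h | h
      · exact ⟨E, hE, sup_le (hAD.trans h) hBE⟩
      · exact ⟨D, hD, sup_le hAD (hBE.trans h)⟩
    · rw [flagSigma_eq_zero hB, mul_zero]
  · rw [flagSigma_eq_zero hA, zero_mul]

variable (hX : ∀ A ∈ X, A ≠ ⊥) (hF : IsChain (· ≤ ·) (F : Set X))
include hX hF

theorem flagSigma_eq_flagSigma_sup {A B J : X} (hA : A ∈ F) (hBA : ¬ B ≤ A)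
    (hJ : (J : Submodule ℂ V) = (A : Submodule ℂ V) ⊔ B) : flagSigma F B = flagSigma F J := by
  have hBJ := (le_of_coe_eq_sup hJ).2
  by_cases hcov : ∃ D ∈ F, B ≤ D
  · obtain ⟨D, hD, hB⟩ := exists_level hX hF hcov
    have hAD : A < D := hF.lt_of_not_ge hD hA fun h => hBA (hB.1.trans h)
    have hJD : J ≤ D := Subtype.coe_le_coe.1 (hJ ▸ sup_le hAD.le hB.1)
    refine flagSigma_eq_of_level hF hD hB (hB.mono hBJ hJD) ?_
    rw [hJ, ← sup_assoc, sup_eq_left.2 (le_predecessor hA hAD)]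
  · rw [flagSigma_eq_zero hcov, flagSigma_eq_zero fun ⟨D, hD, hJD⟩ => hcov ⟨D, hD, hBJ.trans hJD⟩]

theorem flagC_eq_zero (hsup : SupClosed (X : Set (Submodule ℂ V))) {A B : X} (hA : A ∈ F)
    (hAB : IncompRel (· ≤ ·) A B) : flagC F B = 0 := by
  let _ := supSemilattice hsup
  rw [← one_mul (flagC F B)]
  refine mul_upperSum_sub_eq_zero_iff.1 (fun B hBA => ?_) B hAB
  rw [upperSum_flagC, flagSigma_eq_flagSigma_sup (J := A ⊔ B) hX hF hA hBA rfl, sub_self, mul_zero]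

variable [FiniteDimensional ℂ V]

theorem flagSigma_exchange {A B J : X} (hJ : (J : Submodule ℂ V) = (A : Submodule ℂ V) ⊔ B) :
    (flagSigma F A - flagSigma F J) * (flagSigma F B - flagSigma F J) = 0 := by
  obtain ⟨hAJ, hBJ⟩ := le_of_coe_eq_sup hJ
  by_cases hcov : ∃ D ∈ F, J ≤ D
  · obtain ⟨D, hD, hJD⟩ := exists_level hX hF hcov
    by_cases hA : (A : Submodule ℂ V) ≤ predecessor F D
    · have hB : Level F D B := ⟨hBJ.trans hJD.1, fun h => hJD.2 (hJ ▸ sup_le hA h)⟩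
      rw [flagSigma_eq_of_level hF hD hB hJD (by rw [hJ, ← sup_assoc, sup_eq_left.2 hA]), sub_self,
        mul_zero]
    have hA : Level F D A := ⟨hAJ.trans hJD.1, hA⟩
    by_cases hB : (B : Submodule ℂ V) ≤ predecessor F D
    · rw [flagSigma_eq_of_level hF hD hA hJD (by
        rw [hJ, sup_left_comm, sup_eq_left.2 hB, sup_comm]), sub_self, zero_mul]
    exact flagSigma_exchange_of_level hF hD ⟨hBJ.trans hJD.1, hB⟩ hA hJD hJ
  · rw [flagSigma_eq_zero hcov, sub_zero, sub_zero, flagSigma_mul_eq_zero hF hJ hcov]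

theorem flagSigma_pow_eq_zero {q : Submodule ℂ V} {B : X} {k : ℕ} (hk0 : k ≠ 0)
    (hk : finrank ℂ (B : Submodule ℂ V) ≤ finrank ℂ q + k) (hqB : q ≤ B)
    (hq : ∀ D ∈ F, Level F D B → q ≤ predecessor F D) : flagSigma F B ^ k = 0 := by
  by_cases hcov : ∃ D ∈ F, B ≤ D
  · obtain ⟨D, hD, hB⟩ := exists_level hX hF hcov
    refine flagSigma_pow_eq_zero_of_level hF hD hB ?_
    have hrank := finrank_sup_add_le hqB (predecessor F D)
    rw [sup_eq_left.2 (hq D hD hB)] at hrank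
    unfold relRank
    omega
  · rw [flagSigma_eq_zero hcov, zero_pow hk0]

theorem flagSigma_pow_finrank (B : X) : flagSigma F B ^ finrank ℂ (B : Submodule ℂ V) = 0 :=
  flagSigma_pow_eq_zero hX hF (q := ⊥) (Submodule.finrank_eq_zero.not.2 (hX _ B.2)) (by simp)
    bot_le fun _ _ _ => bot_le

theorem flagSigma_pow_finrank_sub {A B : X} (hA : A ∈ F) (hAB : A < B) :
    flagSigma F B ^ (finrank ℂ (B : Submodule ℂ V) - finrank ℂ (A : Submodule ℂ V)) = 0 := by
  have hlt := Submodule.finrank_lt_finrank_of_lt (Subtype.coe_lt_coe.2 hAB)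
  refine flagSigma_pow_eq_zero hX hF (q := A) (by omega) (by omega) hAB.le fun D hD hB =>
    le_predecessor hA (hF.lt_of_not_ge hD hA fun h => hAB.not_ge (hB.1.trans h))

theorem flagSigma_sub_mul_pow {A B : X} (hAB : A < B) : (flagSigma F A - flagSigma F B) *
    flagSigma F B ^ (finrank ℂ (B : Submodule ℂ V) - finrank ℂ (A : Submodule ℂ V)) = 0 := by
  have hlt := Submodule.finrank_lt_finrank_of_lt (Subtype.coe_lt_coe.2 hAB)
  by_cases hlevel : ∃ D ∈ F, Level F D B ∧ Level F D A
  · obtain ⟨D, hD, hB, hA⟩ := hlevel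
    rw [sub_mul, flagSigma_mul_pow_of_level hF hD hB hA hAB.le (by omega), sub_self]
  · rw [flagSigma_pow_eq_zero hX hF (q := A) (by omega) (by omega) hAB.le, mul_zero]
    intro D hD hB
    by_contra hA
    exact hlevel ⟨D, hD, hB, hAB.le.trans hB.1, hA⟩

variable (hsup : SupClosed (X : Set (Submodule ℂ V)))
include hsup

theorem flagC_mul_flagC {A B : X} (hAB : IncompRel (· ≤ ·) A B) : flagC F A * flagC F B = 0 := by
  let _ := supSemilattice hsup
  refine upperSum_sub_mul_upperSum_sub_eq_zero_iff.1 (fun A B => ?_) A B hAB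
  rw [upperSum_flagC]
  exact flagSigma_exchange hX hF rfl

theorem flagC_mul_flagSigma_pow {A B : X} (hAB : A < B) : flagC F A *
    flagSigma F B ^ (finrank ℂ (B : Submodule ℂ V) - finrank ℂ (A : Submodule ℂ V)) = 0 := by
  let _ := supSemilattice hsup
  have h := upperSum_sub_mul_upperSum_pow_eq_zero_iff (u := flagC F) (w := flagC F)
    (rk := fun A : X => finrank ℂ (A : Submodule ℂ V)) (fun A B E hAB => finrank_sup_add_le hAB E)
    (fun _ _ => Commute.all _ _) fun _ _ => flagC_mul_flagC hX hF hsup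
  rw [upperSum_flagC] at h
  exact h.1 (fun _ _ => flagSigma_sub_mul_pow hX hF) A B hAB

theorem prod_flagC_eq_zero {X₁ X₂ : Finset X} (h₁ : X₁ ⊆ F) {A C : X} (hA : A ∈ X₁ ∪ X₂)
    (hC : C ∈ X₁ ∪ X₂) (hAC : IncompRel (· ≤ ·) A C) : ∏ A ∈ X₂, flagC F A = 0 := by
  classical
  rcases Finset.mem_union.1 hA with hA | hA <;> rcases Finset.mem_union.1 hC with hC | hC
  · exact absurd (hF.total (h₁ hA) (h₁ hC)) (not_or.2 hAC)
  · exact Finset.prod_eq_zero hC (flagC_eq_zero hX hF hsup (h₁ hA) hAC)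
  · exact Finset.prod_eq_zero hA (flagC_eq_zero hX hF hsup (h₁ hC) hAC.symm)
  · have hne : A ≠ C := by
      rintro rfl
      exact hAC.1 le_rfl
    rw [← Finset.mul_prod_erase _ _ hA,
      ← Finset.mul_prod_erase _ _ (Finset.mem_erase.2 ⟨hne.symm, hC⟩), ← mul_assoc,
      flagC_mul_flagC hX hF hsup hAC, zero_mul]

theorem prod_flagC_mul_flagSigma_pow {X₁ X₂ : Finset X} {B : X} (h₁ : X₁ ⊆ F)
    (hB₁ : ∀ A ∈ X₁, A < B) (hB₂ : ∀ A ∈ X₂, A < B) :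
    (∏ A ∈ X₂, flagC F A) * flagSigma F B ^ defect (X₁ ∪ X₂) B = 0 := by
  classical
  by_cases hchain : IsChain (· ≤ ·) ((X₁ ∪ X₂ : Finset X) : Set X)
  · rcases (X₁ ∪ X₂).eq_empty_or_nonempty with hempty | hne
    · rw [defect, hempty, Finset.sup_empty, finrank_bot, Nat.sub_zero,
        flagSigma_pow_finrank hX hF B, mul_zero]
    · obtain ⟨A, hA, hsupA⟩ := exists_sup_eq_of_isChain hchain hne
      rw [defect, hsupA]
      rcases Finset.mem_union.1 hA with hA | hA
      · rw [flagSigma_pow_finrank_sub hX hF (h₁ hA) (hB₁ A hA), mul_zero]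
      · rw [← Finset.mul_prod_erase _ _ hA, mul_right_comm,
          flagC_mul_flagSigma_pow hX hF hsup (hB₂ A hA), zero_mul]
  · simp only [IsChain, Set.Pairwise, not_forall, not_or] at hchain
    obtain ⟨A, hA, C, hC, -, hAC⟩ := hchain
    rw [prod_flagC_eq_zero hX hF hsup h₁ hA hC hAC, zero_mul]

end FlagRelations

section TopCoeff

variable {R : Type*} [CommRing R]

/-- The coefficient of the product of all standard basis vectors. -/
def topCoeff (R : Type*) [CommRing R] (n : ℕ) : ExteriorAlgebra R (Fin n → R) →ₗ[R] R :=
  ExteriorAlgebra.liftAlternating (Pi.single n Matrix.detRowAlternating)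

theorem topCoeff_ιMulti {n : ℕ} (v : Fin n → Fin n → R) :
    topCoeff R n (ExteriorAlgebra.ιMulti R n v) = (Matrix.of v).det := by
  rw [topCoeff, ExteriorAlgebra.liftAlternating_apply_ιMulti, Pi.single_eq_same]
  rfl

theorem topCoeff_ιMulti_of_ne {m n : ℕ} (h : m ≠ n) (v : Fin m → Fin n → R) :
    topCoeff R n (ExteriorAlgebra.ιMulti R m v) = 0 := by
  rw [topCoeff, ExteriorAlgebra.liftAlternating_apply_ιMulti, Pi.single_eq_of_ne h]
  rfl

theorem prod_map_ι {ι M : Type*} [AddCommGroup M] [Module R M] (v : ι → M) (L : List ι) :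
    (L.map fun i => ExteriorAlgebra.ι R (v i)).prod =
      ExteriorAlgebra.ιMulti R L.length (v ∘ L.get) := by
  conv_lhs => rw [← List.ofFn_get L, List.map_ofFn]
  rw [ExteriorAlgebra.ιMulti_apply]
  rfl

theorem exists_perm_of_det_ne_zero {n : Type*} [DecidableEq n] [Fintype n] {A : Matrix n n R}
    (h : A.det ≠ 0) : ∃ π : Equiv.Perm n, ∀ i, A (π i) i ≠ 0 := by
  rw [Matrix.det_apply] at h
  obtain ⟨π, -, hπ⟩ := Finset.exists_ne_zero_of_sum_ne_zero h
  exact ⟨π, fun i hi => hπ (smul_eq_zero_of_right _ (Finset.prod_eq_zero (Finset.mem_univ i) hi))⟩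

variable {P : Type*} [PartialOrder P]

open scoped Classical in
/-- The image of `∑_{B ≥ A} e_B` when `e_B` goes to the sum of the standard basis vectors at the
indices `i` with `t i = B`. -/
def upperRow (R : Type*) [CommRing R] {n : ℕ} (t : Fin n → P) (A : P) : Fin n → R :=
  fun i => if A ≤ t i then 1 else 0

theorem rel_le_of_topCoeff_ne_zero {n : ℕ} {t : Fin n → P} {L : List P}
    (h : topCoeff R n (L.map fun A => ExteriorAlgebra.ι R (upperRow R t A)).prod ≠ 0) :
    Multiset.Rel (· ≤ ·) (L : Multiset P) (List.ofFn t) := by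
  rw [prod_map_ι] at h
  obtain rfl : L.length = n := by
    by_contra hne
    exact h (topCoeff_ιMulti_of_ne hne _)
  rw [topCoeff_ιMulti] at h
  obtain ⟨π, hπ⟩ := exists_perm_of_det_ne_zero h
  have hle (i) : L.get (π i) ≤ t i := by
    by_contra hnot
    exact hπ i (if_neg hnot)
  have hL : (L : Multiset P) = Finset.univ.val.map (L.get ∘ π) := by
    rw [Fin.univ_val_map, Multiset.coe_eq_coe.2 (Equiv.Perm.ofFn_comp_perm π L.get),
      List.ofFn_get]
  rw [hL, ← Fin.univ_val_map, Multiset.rel_map]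
  exact Multiset.rel_refl_of_refl_on fun i _ => hle i

theorem topCoeff_self {T : List P} (hT : T.Pairwise (· < ·)) :
    topCoeff R T.length (T.map fun A => ExteriorAlgebra.ι R (upperRow R T.get A)).prod = 1 := by
  rw [prod_map_ι, topCoeff_ιMulti, Matrix.det_of_isUpperTriangular]
  · exact Finset.prod_eq_one fun i _ => if_pos le_rfl
  · exact fun i j hji => if_neg (List.pairwise_iff_get.1 hT j i hji).not_ge

end TopCoeff

section Rel

variable {P : Type*} [PartialOrder P] {rk : P → ℕ} {s t : Multiset P}

theorem sum_map_le_of_rel (hrk : Monotone rk) (h : Multiset.Rel (· ≤ ·) s t) :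
    (s.map rk).sum ≤ (t.map rk).sum :=
  Multiset.sum_le_sum_of_rel_le (Multiset.rel_map.2 (h.mono fun _ _ _ _ hAB => hrk hAB))

theorem eq_of_rel_of_sum_map_eq (hrk : StrictMono rk) (h : Multiset.Rel (· ≤ ·) s t)
    (hsum : (s.map rk).sum = (t.map rk).sum) : s = t := by
  induction h with
  | zero => rfl
  | @cons A B s t hAB h ih =>
    have hle := sum_map_le_of_rel hrk.monotone h
    have hrkAB := hrk.monotone hAB
    simp only [Multiset.map_cons, Multiset.sum_cons] at hsum
    rw [ih (by omega), hAB.eq_of_not_lt fun hlt => (hrk hlt).ne (by omega)]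

end Rel

section Evaluation

variable {V : Type*} [AddCommGroup V] [Module ℂ V] {X : Finset (Submodule ℂ V)} {F : Finset X}
  {n : ℕ} {t : Fin n → X}

/-- The inclusion of the polynomials in the `c_A`. -/
def polyToModel (X : Finset (Submodule ℂ V)) : Poly X →ₐ[ℚ] Model X :=
  (toModel X).comp Algebra.TensorProduct.includeLeft

/-- The product of the `σ_A` over a multiset. -/
def sigmaProd (s : Multiset X) : Model X :=
  polyToModel X (s.map (upperSum (MvPolynomial.X (R := ℚ)))).prod

theorem tau_eq_upperSum : (tau : X → Model X) = upperSum e := rfl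

theorem polyToModel_upperSum (A : X) :
    polyToModel X (upperSum (MvPolynomial.X (R := ℚ)) A) = sigma A := by
  rw [map_upperSum]
  rfl

theorem sigmaProd_cons (A : X) (s : Multiset X) :
    sigmaProd (A ::ₘ s) = sigma A * sigmaProd s := by
  rw [sigmaProd, Multiset.map_cons, Multiset.prod_cons, map_mul, polyToModel_upperSum, sigmaProd]

/-- The homomorphism that sends `c_A` to `flagC F A` and `e_A` to the sum of the standard basis
vectors at the indices `i` with `t i = A`. -/
def evalTensor (F : Finset X) (t : Fin n → X) :
    Poly X ⊗[ℚ] Ext X →ₐ[ℚ] FlagRing F ⊗[ℚ] ExteriorAlgebra ℚ (Fin n → ℚ) :=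
  Algebra.TensorProduct.map (MvPolynomial.aeval (flagC F))
    (ExteriorAlgebra.map (LinearMap.pi fun i => Finsupp.lapply (t i)))

theorem evalTensor_tmul (p : Poly X) (x : Ext X) : evalTensor F t (p ⊗ₜ x) =
    MvPolynomial.aeval (flagC F) p ⊗ₜ
      ExteriorAlgebra.map (LinearMap.pi fun i => Finsupp.lapply (t i)) x := rfl

theorem map_extGen (A : X) :
    ExteriorAlgebra.map (LinearMap.pi fun i => Finsupp.lapply (t i)) (extGen A) =
      ExteriorAlgebra.ι ℚ fun i => Finsupp.single A (1 : ℚ) (t i) :=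
  ExteriorAlgebra.map_apply_ι _ _

theorem upperSum_single_apply (A : X) :
    upperSum (fun B => fun i => Finsupp.single B (1 : ℚ) (t i)) A = upperRow ℚ t A := by
  funext i
  simp only [upperSum, upperRow, Finset.sum_apply, Finsupp.single_apply, Finset.sum_ite_eq']
  classical exact if_congr (by simp) rfl rfl

theorem aeval_upperSum (A : X) :
    MvPolynomial.aeval (flagC F) (upperSum (MvPolynomial.X (R := ℚ)) A) = flagSigma F A := by
  rw [map_upperSum, ← upperSum_flagC]
  simp only [MvPolynomial.aeval_X]

variable [FiniteDimensional ℂ V] (hX : ∀ A ∈ X, A ≠ ⊥) (hF : IsChain (· ≤ ·) (F : Set X))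
  (hsup : SupClosed (X : Set (Submodule ℂ V)))
include hX hF hsup

theorem evalTensor_relator (ht : ∀ i, t i ∈ F) {X₁ : List X} {X₂ : Finset X} {B : X}
    (h₁ : ∀ A ∈ X₁, A < B) (h₂ : ∀ A ∈ X₂, A < B) : evalTensor F t (relator X₁ X₂ B) = 0 := by
  classical
  rw [relator, evalTensor_tmul]
  by_cases h : ∀ A ∈ X₁, A ∈ F
  · have hsum : (∑ C with B ≤ C, MvPolynomial.X C : Poly X) = upperSum MvPolynomial.X B := rfl
    have hzero := prod_flagC_mul_flagSigma_pow hX hF hsup (X₁ := X₁.toFinset) (X₂ := X₂) (B := B)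
      (fun A hA => h A (List.mem_toFinset.1 hA)) (fun A hA => h₁ A (List.mem_toFinset.1 hA)) h₂
    simp only [hsum, map_mul, map_pow, map_prod, MvPolynomial.aeval_X, aeval_upperSum]
    rw [show defect _ _ = defect _ B from rfl, hzero, TensorProduct.zero_tmul]
  · push Not at h
    obtain ⟨A, hA, hAF⟩ := h
    have hzero : ExteriorAlgebra.map (LinearMap.pi fun i => Finsupp.lapply (t i)) (extGen A) =
        0 := by
      rw [map_extGen, ← map_zero (ExteriorAlgebra.ι ℚ)]
      congr 1
      funext i
      exact Finsupp.single_eq_of_ne fun hi => hAF (hi ▸ ht i)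
    rw [map_list_prod, List.prod_eq_zero, TensorProduct.tmul_zero]
    rw [List.map_map]
    exact List.mem_map.2 ⟨A, hA, hzero⟩

theorem evalTensor_eq_zero_of_mem (ht : ∀ i, t i ∈ F) {x : Poly X ⊗[ℚ] Ext X}
    (hx : x ∈ modelIdeal X) : evalTensor F t x = 0 := by
  have hle : TwoSidedIdeal.span (relators X) ≤ TwoSidedIdeal.ker (evalTensor F t) := by
    rw [TwoSidedIdeal.span_le]
    rintro _ ⟨X₁, X₂, B, -, h₁, h₂, rfl⟩
    exact (TwoSidedIdeal.mem_ker _).2 (evalTensor_relator hX hF hsup ht h₁ h₂)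
  exact (TwoSidedIdeal.mem_ker _).1 (hle (TwoSidedIdeal.mem_asIdeal.1 hx))

theorem exists_algHom_model (ht : ∀ i, t i ∈ F) :
    ∃ φ : Model X →ₐ[ℚ] FlagRing F ⊗[ℚ] ExteriorAlgebra ℚ (Fin n → ℚ),
      (∀ s, φ (sigmaProd s) = (s.map (flagSigma F)).prod ⊗ₜ 1) ∧
        ∀ A, φ (tau A) = 1 ⊗ₜ ExteriorAlgebra.ι ℚ (upperRow ℚ t A) := by
  refine ⟨Ideal.Quotient.liftₐ (modelIdeal X) (evalTensor F t)
    fun x hx => evalTensor_eq_zero_of_mem hX hF hsup ht hx, fun s => ?_, fun A => ?_⟩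
  · change evalTensor F t ((s.map (upperSum MvPolynomial.X)).prod ⊗ₜ 1) = _
    rw [evalTensor_tmul, map_one, map_multiset_prod, Multiset.map_map]
    exact congrArg (· ⊗ₜ 1) (congrArg _ (Multiset.map_congr rfl fun A _ => aeval_upperSum A))
  · rw [tau_eq_upperSum, map_upperSum]
    have he (B : X) : Ideal.Quotient.liftₐ (modelIdeal X) (evalTensor F t)
        (fun x hx => evalTensor_eq_zero_of_mem hX hF hsup ht hx) (e B) =
          Algebra.TensorProduct.includeRight
            (ExteriorAlgebra.ι ℚ fun i => Finsupp.single B (1 : ℚ) (t i)) := by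
      change evalTensor F t (1 ⊗ₜ extGen B) = _
      rw [evalTensor_tmul, map_one, map_extGen]
      rfl
    simp only [he]
    rw [← map_upperSum, ← map_upperSum, upperSum_single_apply]
    rfl

theorem exists_functional (ht : ∀ i, t i ∈ F) (u : Multiset X) :
    ∃ θ : Model X →ₗ[ℚ] ℚ, ∀ (L : List X) (s : Multiset X),
      θ ((L.map tau).prod * sigmaProd s) = flagFun F ((s + u).map (flagSigma F)).prod *
        topCoeff ℚ n (L.map fun A => ExteriorAlgebra.ι ℚ (upperRow ℚ t A)).prod := by
  obtain ⟨φ, hσ, hτ⟩ := exists_algHom_model hX hF hsup ht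
  refine ⟨LinearMap.mul' ℚ ℚ ∘ₗ TensorProduct.map
    (flagFun F ∘ₗ LinearMap.mulRight ℚ (u.map (flagSigma F)).prod) (topCoeff ℚ n) ∘ₗ
      φ.toLinearMap, fun L s => ?_⟩
  have hL : φ (L.map tau).prod =
      1 ⊗ₜ (L.map fun A => ExteriorAlgebra.ι ℚ (upperRow ℚ t A)).prod := by
    induction L with
    | nil => exact φ.map_one'
    | cons A L ih =>
      simp only [List.map_cons, List.prod_cons, map_mul, ih, hτ,
        Algebra.TensorProduct.tmul_mul_tmul, one_mul]
  simp only [LinearMap.comp_apply, AlgHom.toLinearMap_apply, map_mul, hL, hσ,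
    Algebra.TensorProduct.tmul_mul_tmul, one_mul, mul_one, TensorProduct.map_tmul,
    LinearMap.mul'_apply, LinearMap.mulRight_apply, Multiset.map_add, Multiset.prod_add]

end Evaluation

section Monomial

variable {V : Type*} [AddCommGroup V] [Module ℂ V] {X : Finset (Submodule ℂ V)}

/-- The multiset in which each `A ∈ S` has the multiplicity `m A`. -/
def expo (S : Finset X) (m : S → ℕ) : Multiset X := ∑ A : S, Multiset.replicate (m A) (A : X)

theorem mu_eq (S : Finset X) (T : List X) (m : S → ℕ) :
    mu S T m = (T.map tau).prod * sigmaProd (expo S m) := by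
  have hprod : ((expo S m).map (upperSum (MvPolynomial.X (R := ℚ)))).prod =
      ∏ A : S, upperSum (MvPolynomial.X (R := ℚ)) (A : X) ^ m A := by
    rw [expo, ← Multiset.coe_mapAddMonoidHom, map_sum, Multiset.prod_sum]
    simp only [Multiset.coe_mapAddMonoidHom, Multiset.map_replicate, Multiset.prod_replicate]
  have hmap := Finset.map_noncommProd Finset.univ
    (fun A : S => upperSum (MvPolynomial.X (R := ℚ)) (A : X) ^ m A)
    (fun _ _ _ _ _ => Commute.all _ _) (polyToModel X)
  rw [Finset.noncommProd_eq_prod] at hmap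
  rw [sigmaProd, hprod, hmap, mu]
  congr 1
  refine Finset.noncommProd_congr rfl (fun A _ => ?_) _
  rw [map_pow, polyToModel_upperSum]

open scoped Classical in
theorem count_expo (S : Finset X) (m : S → ℕ) (A : X) :
    (expo S m).count A = if h : A ∈ S then m ⟨A, h⟩ else 0 := by
  simp only [expo, Multiset.count_sum', Multiset.count_replicate]
  split_ifs with h
  · rw [Finset.sum_eq_single_of_mem ⟨A, h⟩ (Finset.mem_univ _)
      fun B _ hB => if_neg fun hBA => hB (Subtype.ext hBA), if_pos rfl]
  · refine Finset.sum_eq_zero fun B _ => if_neg ?_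
    rintro rfl
    exact h B.2

theorem mem_expo {S : Finset X} {m : S → ℕ} (hm : ∀ A, 0 < m A) {A : X} :
    A ∈ expo S m ↔ A ∈ S := by
  classical
  rw [← Multiset.count_pos, count_expo]
  split_ifs with h
  · simp only [hm, h]
  · simp only [lt_irrefl, h]

theorem BasicIndex.eq_of_expo_eq {r : ℕ} {t t' : BasicIndex X r} (hT : t.T = t'.T)
    (h : expo t.S t.m = expo t'.S t'.m) : t = t' := by
  classical
  have hS : t.S = t'.S := by
    ext A
    rw [← mem_expo t.m_pos, h, mem_expo t'.m_pos]
  obtain ⟨S, T, m, _, _, hm, _, _⟩ := t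
  obtain ⟨S', T', m', _, _, hm', _, _⟩ := t'
  obtain rfl : T = T' := hT
  obtain rfl : S = S' := hS
  obtain rfl : m = m' := by
    funext A
    simpa [count_expo] using congrArg (Multiset.count (A : X)) h
  rfl

end Monomial

section Complement

variable {V : Type*} [AddCommGroup V] [Module ℂ V] {X : Finset (Submodule ℂ V)} {F : Finset X}

theorem predecessor_le (F : Finset X) (A : X) : predecessor F A ≤ A := by
  classical
  exact Finset.sup_le fun _ hB => (Finset.mem_filter.1 hB).2.le

theorem part_of_subset (hX : ∀ A ∈ X, A ≠ ⊥) (hF : IsChain (· ≤ ·) (F : Set X))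
    {u : Multiset X} (hu : ∀ A ∈ u, A ∈ F) {A : X} (hA : A ∈ F) [DecidableEq X] :
    part F A u = Multiset.replicate (u.count A) (A : Submodule ℂ V) := by
  classical
  have hlevel : u.filter (Level F A) = u.filter (· = A) := Multiset.filter_congr fun B hB =>
    ⟨fun h => (level_self hX hF B).unique hF (hu B hB) hA h, fun h => h ▸ level_self hX hF B⟩
  rw [part, hlevel, Multiset.filter_eq', Multiset.map_replicate]

/-- The dimension of a member of `X`. -/
def rk (A : X) : ℕ := finrank ℂ (A : Submodule ℂ V)

open scoped Classical in
/-- The multiset on the flag `F` that completes `s` to the multiset of largest size that is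
supported on `F` and good. -/
def complement (F : Finset X) (s : Multiset X) : Multiset X :=
  ∑ A ∈ F, Multiset.replicate (rk A - finrank ℂ (predecessor F A) - 1 - s.count A) A

theorem mem_of_mem_complement {s : Multiset X} {A : X} (h : A ∈ complement F s) : A ∈ F := by
  obtain ⟨B, hB, hA⟩ := Multiset.mem_sum.1 h
  rwa [Multiset.eq_of_mem_replicate hA]

open scoped Classical in
theorem count_complement (s : Multiset X) {A : X} (hA : A ∈ F) :
    (complement F s).count A = rk A - finrank ℂ (predecessor F A) - 1 - s.count A := by
  simp only [complement, Multiset.count_sum', Multiset.count_replicate]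
  rw [Finset.sum_ite_eq' F A, if_pos hA]

open scoped Classical in
/-- The exponents of the basic monomials: `s` is supported on the flag `F`, and the multiplicity of
each `A ∈ F` is less than the dimension of `A` modulo its predecessor. -/
def Admissible (F : Finset X) (s : Multiset X) : Prop :=
  (∀ A ∈ s, A ∈ F) ∧ ∀ A ∈ F, s.count A + finrank ℂ (predecessor F A) < rk A

variable (hX : ∀ A ∈ X, A ≠ ⊥) (hF : IsChain (· ≤ ·) (F : Set X)) {s : Multiset X}
  (hs : Admissible F s)
include hX hF hs

theorem good_add_complement : Good F (s + complement F s) := by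
  classical
  have hmem : ∀ A ∈ s + complement F s, A ∈ F := fun A hA =>
    (Multiset.mem_add.1 hA).elim (hs.1 A) mem_of_mem_complement
  refine ⟨fun C hC => ⟨C, hmem C hC, le_rfl⟩, fun A hA => ?_⟩
  have hcount := hs.2 A hA
  rw [part_of_subset hX hF hmem hA, Multiset.count_add, count_complement s hA,
    Multiset.card_replicate]
  rw [rk] at *
  refine ⟨by omega, dragon_replicate ?_⟩
  rw [relRank_bot, relRank, sup_eq_right.2 (predecessor_le F A)]
  omega

theorem rel_le_of_good_add_complement {s' : Multiset X} (h : Good F (s' + complement F s)) :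
    Multiset.Rel (· ≤ ·) s' s := by
  classical
  have hcard : ∀ A ∈ F, (part F A s').card = s.count A := by
    intro A hA
    have hgood := (h.2 A hA).1
    have hcount := hs.2 A hA
    rw [part_add, part_of_subset hX hF (fun _ => mem_of_mem_complement) hA, Multiset.card_add,
      Multiset.card_replicate, count_complement s hA] at hgood
    rw [rk] at *
    omega
  have hlevel (C : X) : ∃ A : X, C ∈ s' → A ∈ F ∧ Level F A C := by
    by_cases hC : C ∈ s'
    · obtain ⟨A, hA, hAC⟩ := exists_level hX hF (h.1 C (Multiset.mem_add.2 (Or.inl hC)))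
      exact ⟨A, fun _ => ⟨hA, hAC⟩⟩
    · exact ⟨C, fun h => absurd h hC⟩
  choose lev hlev using hlevel
  have hmap : s = s'.map lev := by
    ext A
    rw [Multiset.count_map]
    by_cases hA : A ∈ F
    · rw [← hcard A hA, part, Multiset.card_map]
      congr 1
      exact Multiset.filter_congr fun C hC =>
        ⟨fun h => h.unique hF hA (hlev C hC).1 (hlev C hC).2, fun h => h ▸ (hlev C hC).2⟩
    · rw [Multiset.count_eq_zero_of_notMem fun h => hA (hs.1 A h), eq_comm,
        Multiset.card_eq_zero, Multiset.filter_eq_nil]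
      exact fun C hC h => hA (h ▸ (hlev C hC).1)
  rw [hmap, Multiset.rel_map_right]
  exact Multiset.rel_refl_of_refl_on fun C hC => (hlev C hC).2.1

end Complement

section Independence

theorem linearIndependent_of_triangular {ι k M : Type*} [Field k] [AddCommGroup M] [Module k M]
    {v : ι → M} (W : ι → ℕ) (θ : ι → M →ₗ[k] k) (h₁ : ∀ i, θ i (v i) ≠ 0)
    (h₂ : ∀ i j, θ i (v j) ≠ 0 → j ≠ i → W j < W i) : LinearIndependent k v := by
  rw [linearIndependent_iff']
  intro s g hg i hi
  induction hW : W i using Nat.strong_induction_on generalizing i with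
  | _ n ih =>
    subst hW
    have hsum := congrArg (θ i) hg
    rw [map_sum, map_zero, Finset.sum_eq_single_of_mem i hi, map_smul, smul_eq_mul] at hsum
    · exact (mul_eq_zero.1 hsum).resolve_right (h₁ i)
    · intro j hj hji
      rw [map_smul, smul_eq_mul, mul_eq_zero]
      by_contra! hne
      exact hne.1 (ih _ (h₂ i j hne.2 hji) j hj rfl)

variable {V : Type*} [AddCommGroup V] [Module ℂ V] {X : Finset (Submodule ℂ V)}

namespace BasicIndex

variable {r : ℕ}

open scoped Classical in
/-- The flag `S ∪ T`. -/
def flagSet (t : BasicIndex X r) : Finset X := t.S ∪ t.T.toFinset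

theorem isChain_flagSet (t : BasicIndex X r) : IsChain (· ≤ ·) (t.flagSet : Set X) := t.flag

variable [FiniteDimensional ℂ V]

theorem admissible (hX : ∀ A ∈ X, A ≠ ⊥) (t : BasicIndex X r) :
    Admissible t.flagSet (expo t.S t.m) := by
  classical
  refine ⟨fun A hA => Finset.mem_union_left _ ((mem_expo t.m_pos).1 hA), fun A _ => ?_⟩
  rw [count_expo]
  split_ifs with h
  · exact Nat.add_lt_of_lt_sub (t.m_lt ⟨A, h⟩)
  · rw [zero_add]
    exact Submodule.finrank_lt_finrank_of_lt
      (lt_of_le_not_ge (predecessor_le _ A) (level_self hX t.isChain_flagSet A).2)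

end BasicIndex

variable [FiniteDimensional ℂ V]

theorem rk_strictMono : StrictMono (rk : X → ℕ) := fun _ _ h =>
  Submodule.finrank_lt_finrank_of_lt h

theorem linearIndependent_mu (hX : ∀ A ∈ X, A ≠ ⊥)
    (hsup : SupClosed (X : Set (Submodule ℂ V))) (r : ℕ) :
    LinearIndependent ℚ fun t : BasicIndex X r => mu t.S t.T t.m := by
  classical
  have hmem (t : BasicIndex X r) (i) : t.T.get i ∈ t.flagSet :=
    Finset.mem_union_right _ (List.mem_toFinset.2 (List.get_mem _ _))
  choose θ hθ using fun t : BasicIndex X r => exists_functional hX t.isChain_flagSet hsup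
    (hmem t) (complement t.flagSet (expo t.S t.m))
  refine linearIndependent_of_triangular
    (fun t => (t.T.map rk).sum + ((expo t.S t.m).map rk).sum) θ (fun t => ?_) fun t t' h hne => ?_
  · have hgood := good_add_complement hX t.isChain_flagSet (t.admissible hX)
    rw [mu_eq, hθ, flagFun_prod, if_pos hgood, topCoeff_self t.sorted, one_mul]
    exact one_ne_zero
  · rw [mu_eq, hθ, flagFun_prod] at h
    have hS : Multiset.Rel (· ≤ ·) (expo t'.S t'.m) (expo t.S t.m) :=
      rel_le_of_good_add_complement hX t.isChain_flagSet (t.admissible hX)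
        (of_not_not fun hbad => left_ne_zero_of_mul h (if_neg hbad))
    have hT := rel_le_of_topCoeff_ne_zero (right_ne_zero_of_mul h)
    rw [List.ofFn_get] at hT
    have hSle := sum_map_le_of_rel rk_strictMono.monotone hS
    have hTle := sum_map_le_of_rel rk_strictMono.monotone hT
    simp only [Multiset.map_coe, Multiset.sum_coe] at hTle
    by_contra hlt
    refine hne (BasicIndex.eq_of_expo_eq ?_ (eq_of_rel_of_sum_map_eq rk_strictMono hS (by omega)))
    have hperm := Multiset.coe_eq_coe.1 (eq_of_rel_of_sum_map_eq rk_strictMono hT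
      (by simp only [Multiset.map_coe, Multiset.sum_coe]; omega))
    exact hperm.eq_of_pairwise (le := (· < ·)) (fun _ _ _ _ h h' => absurd h h'.not_gt)
      t'.sorted t.sorted

end Independence

section Relations

variable {V : Type*} [AddCommGroup V] [Module ℂ V] {X : Finset (Submodule ℂ V)}

/-- The inclusion of the exterior polynomials in the `e_A`. -/
def extToModel (X : Finset (Submodule ℂ V)) : Ext X →ₐ[ℚ] Model X :=
  (toModel X).comp Algebra.TensorProduct.includeRight

theorem toModel_tmul (p : Poly X) (x : Ext X) :
    toModel X (p ⊗ₜ x) = extToModel X x * polyToModel X p := by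
  change _ = toModel X (1 ⊗ₜ x) * toModel X (p ⊗ₜ 1)
  rw [← map_mul, Algebra.TensorProduct.tmul_mul_tmul, one_mul, mul_one]

theorem commute_polyToModel_extToModel (p : Poly X) (x : Ext X) :
    Commute (polyToModel X p) (extToModel X x) := by
  rw [Commute, SemiconjBy, ← toModel_tmul]
  change toModel X (p ⊗ₜ 1) * toModel X (1 ⊗ₜ x) = _
  rw [← map_mul, Algebra.TensorProduct.tmul_mul_tmul, one_mul, mul_one]

theorem extToModel_upperSum (A : X) : extToModel X (upperSum extGen A) = tau A := by
  rw [map_upperSum]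
  rfl

theorem upperSum_extGen (A : X) :
    upperSum extGen A = ExteriorAlgebra.ι ℚ (upperSum (fun B => Finsupp.single B 1) A) :=
  (map_upperSum _ _ _).symm

theorem commute_sigma_tau (A B : X) : Commute (sigma A) (tau B) := by
  rw [← polyToModel_upperSum, ← extToModel_upperSum]
  exact commute_polyToModel_extToModel _ _

theorem tau_mul_self (A : X) : tau A * tau A = 0 := by
  rw [← extToModel_upperSum, upperSum_extGen, ← map_mul, ExteriorAlgebra.ι_sq_zero, map_zero]

theorem tau_mul_tau (A B : X) : tau A * tau B = -(tau B * tau A) := by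
  simp only [← extToModel_upperSum, upperSum_extGen, ← map_mul, ← map_neg]
  rw [eq_neg_of_add_eq_zero_left (ExteriorAlgebra.ι_add_mul_swap _ _)]

theorem prod_e_mul_prod_c_mul_sigma_pow [DecidableEq X] {X₁ : List X} {X₂ : Finset X} {B : X}
    (hn : X₁.Nodup) (h₁ : ∀ A ∈ X₁, A < B) (h₂ : ∀ A ∈ X₂, A < B) :
    (X₁.map e).prod * (polyToModel X (∏ A ∈ X₂, MvPolynomial.X A) *
      sigma B ^ defect (X₁.toFinset ∪ X₂) B) = 0 := by
  have h : toModel X (relator X₁ X₂ B) = 0 :=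
    Ideal.Quotient.eq_zero_iff_mem.2 (TwoSidedIdeal.mem_asIdeal.2
      (TwoSidedIdeal.subset_span ⟨X₁, X₂, B, hn, h₁, h₂, rfl⟩))
  rw [relator, toModel_tmul, map_list_prod, List.map_map, map_mul, map_pow] at h
  rw [← polyToModel_upperSum, ← h]
  congr!

theorem polyToModel_X (A : X) : polyToModel X (MvPolynomial.X A) = c A := rfl

theorem defect_eq {Y : Finset X} {q : Submodule ℂ V}
    (h : (Y.sup fun A => (A : Submodule ℂ V)) = q) (B : X) :
    defect Y B = rk B - finrank ℂ q := by
  rw [defect, h, rk]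

theorem sigma_pow_rk (B : X) : sigma B ^ rk B = 0 := by
  classical
  have h := prod_e_mul_prod_c_mul_sigma_pow (X₁ := []) (X₂ := ∅) (B := B) (by simp) (by simp)
    (by simp)
  rw [defect_eq (q := ⊥) (by simp)] at h
  simpa using h

/-- The generators of the model: `c` for `false` and `e` for `true`. -/
def gen (k : Bool) : X → Model X := cond k e c

theorem gen_mul_sigma_pow (k : Bool) {A B : X} (hAB : A < B) :
    gen k A * sigma B ^ (rk B - rk A) = 0 := by
  classical
  cases k
  · have h := prod_e_mul_prod_c_mul_sigma_pow (X₁ := []) (X₂ := {A}) (B := B) (by simp) (by simp)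
      (by simpa using hAB)
    rw [defect_eq (q := A) (by simp)] at h
    simpa [gen, rk, polyToModel_X] using h
  · have h := prod_e_mul_prod_c_mul_sigma_pow (X₁ := [A]) (X₂ := ∅) (B := B) (by simp)
      (by simpa using hAB) (by simp)
    rw [defect_eq (q := A) (by simp)] at h
    simpa [gen, rk, polyToModel_X] using h

variable (hsup : SupClosed (X : Set (Submodule ℂ V)))
include hsup

theorem prod_e_mul_prod_c_eq_zero [DecidableEq X] {X₁ : List X} {X₂ : Finset X} {A B : X}
    (hn : X₁.Nodup) (hX : X₁.toFinset ∪ X₂ = {A, B}) (hAB : IncompRel (· ≤ ·) A B) :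
    (X₁.map e).prod * polyToModel X (∏ A ∈ X₂, MvPolynomial.X A) = 0 := by
  let _ := supSemilattice hsup
  have hlt : ∀ C ∈ X₁.toFinset ∪ X₂, C < A ⊔ B := by
    intro C hC
    rw [hX, Finset.mem_insert, Finset.mem_singleton] at hC
    rcases hC with rfl | rfl
    · exact left_lt_sup.2 hAB.2
    · exact right_lt_sup.2 hAB.1
  have h := prod_e_mul_prod_c_mul_sigma_pow hn
    (fun C hC => hlt C (Finset.mem_union_left _ (List.mem_toFinset.2 hC)))
    fun C hC => hlt C (Finset.mem_union_right _ hC)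
  have hsupAB : (({A, B} : Finset X).sup fun C => (C : Submodule ℂ V)) = (A ⊔ B : X) := by
    rw [Finset.sup_insert, Finset.sup_singleton]
    rfl
  rwa [hX, defect_eq hsupAB, rk, Nat.sub_self, pow_zero, mul_one] at h

theorem gen_mul_gen (k k' : Bool) {A B : X} (hAB : IncompRel (· ≤ ·) A B) :
    gen k A * gen k' B = 0 := by
  classical
  have hne : A ≠ B := fun h => hAB.1 h.le
  have h_e_c {A B : X} (hAB : IncompRel (· ≤ ·) A B) : e A * c B = 0 := by
    simpa [polyToModel_X] using prod_e_mul_prod_c_eq_zero hsup (X₁ := [A]) (X₂ := {B})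
      (List.nodup_singleton A) rfl hAB
  cases k <;> cases k'
  · simpa [gen, polyToModel_X, Finset.prod_pair hne] using
      prod_e_mul_prod_c_eq_zero hsup (X₁ := []) (X₂ := {A, B}) List.nodup_nil (by simp) hAB
  · exact (commute_polyToModel_extToModel (MvPolynomial.X A) (extGen B)).eq.trans
      (h_e_c hAB.symm)
  · exact h_e_c hAB
  · simpa [gen] using prod_e_mul_prod_c_eq_zero hsup (X₁ := [A, B]) (X₂ := ∅) (by simp [hne])
      (by simp) hAB

theorem upperSum_gen_exchange (k k' : Bool) {A B J : X}
    (hJ : (J : Submodule ℂ V) = (A : Submodule ℂ V) ⊔ B) :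
    upperSum (gen k) A * upperSum (gen k') B =
      upperSum (gen k) A * upperSum (gen k') J + upperSum (gen k) J * upperSum (gen k') B -
        upperSum (gen k) J * upperSum (gen k') J := by
  let _ := supSemilattice hsup
  obtain rfl : J = A ⊔ B := Subtype.ext hJ
  have h := upperSum_sub_mul_upperSum_sub_eq_zero_iff.2 (fun _ _ => gen_mul_gen hsup k k') A B
  rw [← sub_eq_zero, ← h]
  noncomm_ring

theorem upperSum_gen_mul_sigma_pow [FiniteDimensional ℂ V] (k : Bool) {A B : X} (hAB : A < B) :
    upperSum (gen k) A * sigma B ^ (rk B - rk A) =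
      upperSum (gen k) B * sigma B ^ (rk B - rk A) := by
  let _ := supSemilattice hsup
  have hrk (A B E : X) (hAB : A ≤ B) : rk (E ⊔ B) + rk A ≤ rk (E ⊔ A) + rk B :=
    finrank_sup_add_le (Subtype.coe_le_coe.2 hAB) (E : Submodule ℂ V)
  rw [← sub_eq_zero, ← sub_mul]
  exact (upperSum_sub_mul_upperSum_pow_eq_zero_iff hrk commute_c
    fun _ _ => gen_mul_gen hsup k false).2 (fun _ _ => gen_mul_sigma_pow k) A B hAB

end Relations

section Straightening

variable {V : Type*} [AddCommGroup V] [Module ℂ V] {X : Finset (Submodule ℂ V)}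

/-- The product of the letters of a word, where `(false, A)` stands for `σ_A` and `(true, A)` for
`τ_A`. -/
def wordProd (l : List (Bool × X)) : Model X := (l.map fun p => upperSum (gen p.1) p.2).prod

/-- The degree of the product of a word. -/
def wordDegree (l : List (Bool × X)) : ℕ := (l.map fun p => cond p.1 1 2).sum

/-- The total dimension of the subspaces in a word. -/
def weight (l : List (Bool × X)) : ℕ := (l.map fun p => rk p.2).sum

theorem wordProd_cons (p : Bool × X) (l : List (Bool × X)) :
    wordProd (p :: l) = upperSum (gen p.1) p.2 * wordProd l := List.prod_cons

theorem wordProd_append (l l' : List (Bool × X)) :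
    wordProd (l ++ l') = wordProd l * wordProd l' := by
  rw [wordProd, List.map_append, List.prod_append, wordProd, wordProd]

theorem wordProd_replicate (n : ℕ) (A : X) :
    wordProd (List.replicate n (false, A)) = sigma A ^ n := by
  rw [wordProd, List.map_replicate, List.prod_replicate]
  rfl

theorem wordDegree_cons (p : Bool × X) (l : List (Bool × X)) :
    wordDegree (p :: l) = cond p.1 1 2 + wordDegree l := List.sum_cons

theorem weight_cons (p : Bool × X) (l : List (Bool × X)) :
    weight (p :: l) = rk p.2 + weight l := List.sum_cons

theorem wordDegree_perm {l l' : List (Bool × X)} (h : l.Perm l') : wordDegree l = wordDegree l' :=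
  (h.map _).sum_eq

theorem weight_perm {l l' : List (Bool × X)} (h : l.Perm l') : weight l = weight l' :=
  (h.map _).sum_eq

theorem upperSum_gen_mul_upperSum_gen (k k' : Bool) (A B : X) :
    upperSum (gen k) A * upperSum (gen k') B = upperSum (gen k') B * upperSum (gen k) A ∨
      upperSum (gen k) A * upperSum (gen k') B = -(upperSum (gen k') B * upperSum (gen k) A) := by
  cases k <;> cases k'
  · exact Or.inl (commute_sigma A B)
  · exact Or.inl (commute_sigma_tau A B)
  · exact Or.inl (commute_sigma_tau B A).symm
  · exact Or.inr (tau_mul_tau A B)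

theorem wordProd_perm {l l' : List (Bool × X)} (h : l.Perm l') :
    wordProd l = wordProd l' ∨ wordProd l = -wordProd l' := by
  induction h with
  | nil => exact Or.inl rfl
  | cons p _ ih => rcases ih with ih | ih <;> simp [wordProd_cons, ih]
  | swap p q l =>
    simp only [wordProd_cons, ← mul_assoc]
    rcases upperSum_gen_mul_upperSum_gen q.1 p.1 q.2 p.2 with h | h <;> simp [h]
  | trans _ _ ih₁ ih₂ => rcases ih₁ with h₁ | h₁ <;> rcases ih₂ with h₂ | h₂ <;> simp [h₁, h₂]

theorem wordProd_mem_of_perm {N : Submodule ℚ (Model X)} {l l' : List (Bool × X)}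
    (h : l.Perm l') (hl : wordProd l' ∈ N) : wordProd l ∈ N := by
  rcases wordProd_perm h with h | h <;> rw [h]
  exacts [hl, N.neg_mem hl]

theorem weight_le [FiniteDimensional ℂ V] (l : List (Bool × X)) :
    weight l ≤ wordDegree l * finrank ℂ V := by
  induction l with
  | nil => exact Nat.zero_le _
  | cons p l ih =>
    rw [weight_cons, wordDegree_cons, add_mul]
    refine add_le_add ((Submodule.finrank_le _).trans (Nat.le_mul_of_pos_left _ ?_)) ih
    cases p.1 <;> decide

/-- The span of the products of the words of the same degree as `l` and of larger weight. -/
def heavierSpan (l : List (Bool × X)) : Submodule ℚ (Model X) :=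
  Submodule.span ℚ (wordProd '' {l' | wordDegree l' = wordDegree l ∧ weight l < weight l'})

theorem heavierSpan_perm {l l' : List (Bool × X)} (h : l.Perm l') :
    heavierSpan l = heavierSpan l' := by
  simp only [heavierSpan, wordDegree_perm h, weight_perm h]

theorem wordProd_mem_heavierSpan_of_perm {l l' : List (Bool × X)} (h : l.Perm l')
    (hl : wordProd l' ∈ heavierSpan l') : wordProd l ∈ heavierSpan l :=
  heavierSpan_perm h ▸ wordProd_mem_of_perm h hl

theorem exists_perm_cons_cons {α : Type*} {l : List α} {p q : α} (hp : p ∈ l) (hq : q ∈ l)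
    (hpq : p ≠ q) : ∃ l', l.Perm (p :: q :: l') := by
  classical
  exact ⟨_, (List.perm_cons_erase hp).trans
    ((List.perm_cons_erase ((List.mem_erase_of_ne hpq.symm).2 hq)).cons p)⟩

theorem wordProd_eq_zero_of_duplicate {A : X} {l : List (Bool × X)}
    (h : List.Duplicate (true, A) l) : wordProd l = 0 := by
  obtain ⟨l', hl'⟩ := (List.duplicate_iff_sublist.1 h).exists_perm_append
  refine (Submodule.mem_bot ℚ).1 (wordProd_mem_of_perm hl' ((Submodule.mem_bot ℚ).2 ?_))
  rw [List.cons_append, List.cons_append, wordProd_cons, wordProd_cons, ← mul_assoc]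
  exact (congrArg (· * _) (tau_mul_self A)).trans (zero_mul _)

theorem wordProd_eq_zero_of_rk_le {l : List (Bool × X)} {A : X}
    (h : (List.replicate (rk A) (false, A)).Sublist l) : wordProd l = 0 := by
  obtain ⟨l', hperm⟩ := h.exists_perm_append
  refine (Submodule.mem_bot ℚ).1 (wordProd_mem_of_perm hperm ((Submodule.mem_bot ℚ).2 ?_))
  rw [wordProd_append, wordProd_replicate, sigma_pow_rk, zero_mul]

variable [FiniteDimensional ℂ V] (hsup : SupClosed (X : Set (Submodule ℂ V)))

include hsup in
theorem wordProd_mem_heavierSpan_of_incompRel {l : List (Bool × X)} {p q : Bool × X} (hp : p ∈ l)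
    (hq : q ∈ l) (hpq : IncompRel (· ≤ ·) p.2 q.2) : wordProd l ∈ heavierSpan l := by
  obtain ⟨k, A⟩ := p
  obtain ⟨k', B⟩ := q
  obtain ⟨l, hperm⟩ := exists_perm_cons_cons hp hq fun h => hpq.1 (congrArg Prod.snd h).le
  refine wordProd_mem_heavierSpan_of_perm hperm ?_
  obtain ⟨J, hJ⟩ : ∃ J : X, (J : Submodule ℂ V) = (A : Submodule ℂ V) ⊔ B :=
    ⟨⟨_, hsup A.2 B.2⟩, rfl⟩
  obtain ⟨hAJ, hBJ⟩ := le_of_coe_eq_sup hJ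
  have hA : rk A < rk J := rk_strictMono (lt_of_le_of_ne hAJ fun h => hpq.2 (h ▸ hBJ))
  have hB : rk B < rk J := rk_strictMono (lt_of_le_of_ne hBJ fun h => hpq.1 (h ▸ hAJ))
  have hexchange : wordProd ((k, A) :: (k', B) :: l) = wordProd ((k, A) :: (k', J) :: l) +
      wordProd ((k, J) :: (k', B) :: l) - wordProd ((k, J) :: (k', J) :: l) := by
    simp only [wordProd_cons, ← mul_assoc, ← add_mul, ← sub_mul,
      upperSum_gen_exchange hsup k k' hJ]
  rw [hexchange]
  refine Submodule.sub_mem _ (Submodule.add_mem _ ?_ ?_) ?_ <;>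
    refine Submodule.subset_span (Set.mem_image_of_mem _ ⟨?_, ?_⟩) <;>
    simp only [wordDegree_cons, weight_cons] <;>
    omega

include hsup in
theorem wordProd_mem_heavierSpan_of_lt {l : List (Bool × X)} {k : Bool} {A B : X}
    (hBA : B < A) (hB : (k, B) ∈ l) (h : (List.replicate (rk A - rk B) (false, A)).Sublist l) :
    wordProd l ∈ heavierSpan l := by
  classical
  obtain ⟨l', hperm⟩ := h.exists_perm_append
  have hB' : (k, B) ∈ l' := (List.mem_append.1 (hperm.subset hB)).resolve_left fun h =>
    hBA.ne (congrArg Prod.snd (List.eq_of_mem_replicate h))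
  have hperm' : l.Perm ((k, B) :: (List.replicate (rk A - rk B) (false, A) ++ l'.erase (k, B))) :=
    hperm.trans (((List.perm_cons_erase hB').append_left _).trans List.perm_middle)
  refine wordProd_mem_heavierSpan_of_perm hperm' (Submodule.subset_span
    ⟨(k, A) :: (List.replicate (rk A - rk B) (false, A) ++ l'.erase (k, B)), ⟨?_, ?_⟩, ?_⟩)
  · simp only [wordDegree_cons]
  · simp only [weight_cons]
    exact Nat.add_lt_add_right (rk_strictMono hBA) _
  · simp only [wordProd_cons, wordProd_append, wordProd_replicate, ← mul_assoc,
      upperSum_gen_mul_sigma_pow hsup k hBA]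

end Straightening

section OrderedWord

variable {V : Type*} [AddCommGroup V] [Module ℂ V] {X : Finset (Submodule ℂ V)}

theorem exists_pairwise_lt_perm {α : Type*} [PartialOrder α] {L : List α} (hn : L.Nodup)
    (hL : ∀ a ∈ L, ∀ b ∈ L, a ≤ b ∨ b ≤ a) : ∃ T : List α, L.Perm T ∧ T.Pairwise (· < ·) := by
  classical
  let r : α → α → Prop := fun a b => toLinearExtension a ≤ toLinearExtension b
  have : Std.Total r := ⟨fun a b => le_total (toLinearExtension a) (toLinearExtension b)⟩
  have : IsTrans α r := ⟨fun _ _ _ => le_trans⟩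
  have hperm := List.perm_insertionSort r L
  refine ⟨_, hperm.symm, ((List.pairwise_insertionSort r L).and
    (hperm.nodup_iff.2 hn)).imp_of_mem fun {a b} ha hb ⟨hab, hne⟩ => ?_⟩
  rcases hL a (hperm.mem_iff.1 ha) b (hperm.mem_iff.1 hb) with h | h
  · exact lt_of_le_of_ne h hne
  · exact absurd (le_antisymm hab (toLinearExtension.monotone h)) hne

/-- The word in which the `τ_A`, for `A` in `T`, precede the `σ_A`, for `A` in `L`. -/
def orderedWord (T L : List X) : List (Bool × X) := T.map (Prod.mk true) ++ L.map (Prod.mk false)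

theorem mem_orderedWord {T L : List X} {A : X} (h : A ∈ L ∨ A ∈ T) :
    ∃ k, (k, A) ∈ orderedWord T L := by
  rcases h with h | h
  · exact ⟨false, List.mem_append_right _ (List.mem_map_of_mem h)⟩
  · exact ⟨true, List.mem_append_left _ (List.mem_map_of_mem h)⟩

theorem wordProd_orderedWord (T L : List X) :
    wordProd (orderedWord T L) = (T.map tau).prod * sigmaProd L := by
  have hL : sigmaProd L = (L.map sigma).prod := by
    induction L with
    | nil => exact map_one _
    | cons A L ih =>
      rw [← Multiset.cons_coe, sigmaProd_cons, ih, List.map_cons, List.prod_cons]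
  rw [orderedWord, wordProd_append, wordProd, wordProd, List.map_map, List.map_map, hL]
  rfl

theorem wordProd_orderedWord_eq_zero_of_duplicate {T L : List X} {A : X}
    (hA : List.Duplicate A T) : wordProd (orderedWord T L) = 0 := by
  refine wordProd_eq_zero_of_duplicate (A := A) ?_
  rw [List.duplicate_iff_sublist] at hA ⊢
  exact (hA.map (Prod.mk true)).trans (List.sublist_append_left _ _)

theorem wordDegree_orderedWord (T L : List X) :
    wordDegree (orderedWord T L) = T.length + 2 * L.length := by
  rw [orderedWord, wordDegree, List.map_append, List.sum_append, List.map_map, List.map_map]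
  simp [Function.comp_def, mul_comm]

theorem exists_perm_orderedWord (l : List (Bool × X)) : ∃ T L, l.Perm (orderedWord T L) := by
  induction l with
  | nil => exact ⟨[], [], List.Perm.nil⟩
  | cons p l ih =>
    obtain ⟨T, L, h⟩ := ih
    obtain ⟨_ | _, A⟩ := p
    · exact ⟨T, A :: L, (h.cons _).trans List.perm_middle.symm⟩
    · exact ⟨A :: T, L, h.cons _⟩

theorem card_expo (S : Finset X) (m : S → ℕ) : (expo S m).card = ∑ A, m A := by
  simp only [expo, Multiset.card_sum, Multiset.card_replicate]

open scoped Classical in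
theorem expo_toFinset (s : Multiset X) :
    expo s.toFinset (fun A => s.count (A : X)) = s := by
  ext A
  rw [count_expo]
  split_ifs with h
  · rfl
  · exact (Multiset.count_eq_zero_of_notMem (mt Multiset.mem_toFinset.2 h)).symm

open scoped Classical in
theorem exists_mu_eq {T L : List X} (hT : T.Pairwise (· < ·))
    (hflag : IsChain (· ≤ ·) ((L.toFinset ∪ T.toFinset : Finset X) : Set X))
    (hL : ∀ A ∈ L, Multiset.count A L <
      rk A - finrank ℂ (predecessor (L.toFinset ∪ T.toFinset) A)) :
    ∃ t : BasicIndex X (wordDegree (orderedWord T L)),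
      mu t.S t.T t.m = wordProd (orderedWord T L) := by
  have hexpo : expo L.toFinset (fun A => Multiset.count (A : X) L) = L := expo_toFinset _
  refine ⟨⟨L.toFinset, T, fun A => Multiset.count (A : X) L, hT, hflag,
    fun A => Multiset.count_pos.2 (Multiset.mem_coe.2 (List.mem_toFinset.1 A.2)),
    fun A => hL A (List.mem_toFinset.1 A.2), ?_⟩, ?_⟩
  · rw [← card_expo, hexpo, Multiset.coe_card, wordDegree_orderedWord]
  · rw [mu_eq, wordProd_orderedWord]
    exact congrArg (fun s => (T.map tau).prod * sigmaProd s) hexpo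

end OrderedWord

section BasicSpan

variable {V : Type*} [AddCommGroup V] [Module ℂ V] {X : Finset (Submodule ℂ V)}
  [FiniteDimensional ℂ V] (hsup : SupClosed (X : Set (Submodule ℂ V)))
include hsup

open scoped Classical in
theorem wordProd_mem_heavierSpan_of_le_count {T L : List X} {A : X}
    (hflag : IsChain (· ≤ ·) ((L.toFinset ∪ T.toFinset : Finset X) : Set X))
    (hA : rk A - finrank ℂ (predecessor (L.toFinset ∪ T.toFinset) A) ≤ Multiset.count A L) :
    wordProd (orderedWord T L) ∈ heavierSpan (orderedWord T L) := by
  have hsub {n : ℕ} (hn : n ≤ Multiset.count A L) :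
      (List.replicate n (false, A)).Sublist (orderedWord T L) := by
    rw [← List.map_replicate]
    have hreplicate := Multiset.replicate_le_coe.1 (Multiset.le_count_iff_replicate_le.1 hn)
    exact (hreplicate.map _).trans (List.sublist_append_right _ _)
  rcases predecessor_cases hflag A with hpred | ⟨B, hB, hBA, hpred⟩
  · rw [hpred, finrank_bot, Nat.sub_zero] at hA
    rw [wordProd_eq_zero_of_rk_le (hsub hA)]
    exact Submodule.zero_mem _
  · rw [hpred] at hA
    obtain ⟨k, hk⟩ := mem_orderedWord (T := T) (L := L) (A := B) (by simpa using hB)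
    exact wordProd_mem_heavierSpan_of_lt hsup hBA hk (hsub hA)

theorem wordProd_mem_heavierSpan_or_mu (l : List (Bool × X)) :
    wordProd l ∈ heavierSpan l ∨
      ∃ t : BasicIndex X (wordDegree l), wordProd l ∈ Submodule.span ℚ {mu t.S t.T t.m} := by
  classical
  by_contra! h
  obtain ⟨hheavy, hmu⟩ := h
  have hcomp : ∀ p ∈ l, ∀ q ∈ l, p.2 ≤ q.2 ∨ q.2 ≤ p.2 := by
    intro p hp q hq
    by_contra! hpq
    exact hheavy (wordProd_mem_heavierSpan_of_incompRel hsup hp hq hpq)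
  obtain ⟨T, L, hl⟩ := exists_perm_orderedWord l
  have hcompX {A B : X} (hA : A ∈ L ∨ A ∈ T) (hB : B ∈ L ∨ B ∈ T) : A ≤ B ∨ B ≤ A := by
    obtain ⟨k, hA⟩ := mem_orderedWord hA
    obtain ⟨k', hB⟩ := mem_orderedWord hB
    exact hcomp _ (hl.mem_iff.2 hA) _ (hl.mem_iff.2 hB)
  have hnodup : T.Nodup := by
    by_contra hT
    obtain ⟨A, hA⟩ := List.exists_duplicate_iff_not_nodup.2 hT
    refine hheavy (wordProd_mem_heavierSpan_of_perm hl ?_)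
    rw [wordProd_orderedWord_eq_zero_of_duplicate hA]
    exact Submodule.zero_mem _
  obtain ⟨T', hTT', hT'⟩ := exists_pairwise_lt_perm hnodup fun A hA B hB =>
    hcompX (Or.inr hA) (Or.inr hB)
  have hl' : l.Perm (orderedWord T' L) := hl.trans ((hTT'.map _).append_right _)
  have hflag : IsChain (· ≤ ·) ((L.toFinset ∪ T'.toFinset : Finset X) : Set X) := by
    intro A hA B hB _
    simp only [Finset.coe_union, Set.mem_union, Finset.mem_coe, List.mem_toFinset,
      ← hTT'.mem_iff] at hA hB
    exact hcompX hA hB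
  have hcount : ∀ A ∈ L, Multiset.count A L <
      rk A - finrank ℂ (predecessor (L.toFinset ∪ T'.toFinset) A) := by
    intro A _
    by_contra! hA
    exact hheavy (wordProd_mem_heavierSpan_of_perm hl'
      (wordProd_mem_heavierSpan_of_le_count hsup hflag hA))
  obtain ⟨t, ht⟩ := exists_mu_eq hT' hflag hcount
  rw [wordDegree_perm hl'] at hmu
  exact hmu t (wordProd_mem_of_perm hl' (ht ▸ Submodule.mem_span_singleton_self _))

theorem wordProd_mem_span_mu {r : ℕ} {l : List (Bool × X)} (hl : wordDegree l = r) :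
    wordProd l ∈ Submodule.span ℚ (Set.range fun t : BasicIndex X r => mu t.S t.T t.m) := by
  induction hn : r * finrank ℂ V - weight l using Nat.strong_induction_on generalizing l with
  | _ n ih =>
    subst hn hl
    rcases wordProd_mem_heavierSpan_or_mu hsup l with h | ⟨t, ht⟩
    · refine Submodule.span_le.2 ?_ h
      rintro _ ⟨l', ⟨hdeg, hlt⟩, rfl⟩
      have hle := weight_le l'
      rw [hdeg] at hle
      exact ih _ (by omega) hdeg rfl
    · exact Submodule.span_mono (Set.singleton_subset_iff.2 (Set.mem_range_self t)) ht

end BasicSpan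

section Degree

variable {V : Type*} [AddCommGroup V] [Module ℂ V] {X : Finset (Submodule ℂ V)}

theorem homogeneousSubmodule_eq_span_pow (i : ℕ) :
    MvPolynomial.homogeneousSubmodule X ℚ i =
      Submodule.span ℚ (Set.range (upperSum MvPolynomial.X : X → Poly X)) ^ i := by
  rw [← MvPolynomial.homogeneousSubmodule_one_pow, MvPolynomial.homogeneousSubmodule_one_eq_span_X,
    span_range_upperSum]

theorem span_range_extGen :
    Submodule.span ℚ (Set.range (extGen : X → Ext X)) = LinearMap.range (ExteriorAlgebra.ι ℚ) := by
  rw [← Finsupp.range_linearCombination]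
  congr 1
  ext A
  simp [extGen]

theorem exteriorPower_eq_span_pow (j : ℕ) :
    (⋀[ℚ]^j (X →₀ ℚ) : Submodule ℚ (Ext X)) =
      Submodule.span ℚ (Set.range (upperSum extGen : X → Ext X)) ^ j := by
  rw [span_range_upperSum, span_range_extGen]

open scoped Pointwise in
theorem exists_list_of_mem_pow {ι R : Type*} [Monoid R] {u : ι → R} {j : ℕ} {x : R}
    (hx : x ∈ Set.range u ^ j) : ∃ L : List ι, L.length = j ∧ (L.map u).prod = x := by
  obtain ⟨f, rfl⟩ := Set.mem_pow.1 hx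
  choose g hg using fun i => (f i).2
  refine ⟨List.ofFn g, List.length_ofFn, ?_⟩
  rw [List.map_ofFn]
  exact congrArg (fun f => (List.ofFn f).prod) (funext hg)

theorem list_prod_mem_span_range_pow {ι k R : Type*} [CommSemiring k] [Semiring R] [Algebra k R]
    (u : ι → R) (L : List ι) :
    (L.map u).prod ∈ Submodule.span k (Set.range u) ^ L.length := by
  induction L with
  | nil => exact Submodule.one_le.1 le_rfl
  | cons i L ih =>
    rw [List.map_cons, List.prod_cons, List.length_cons, pow_succ']
    exact Submodule.mul_mem_mul (Submodule.subset_span (Set.mem_range_self i)) ih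

theorem toModel_tmul_prod_upperSum (T L : List X) :
    toModel X ((L.map (upperSum MvPolynomial.X)).prod ⊗ₜ (T.map (upperSum extGen)).prod) =
      wordProd (orderedWord T L) := by
  rw [toModel_tmul, wordProd_orderedWord, map_list_prod, List.map_map]
  congr 3
  exact funext extToModel_upperSum

theorem wordProd_orderedWord_mem_modelDegree (T L : List X) :
    wordProd (orderedWord T L) ∈ modelDegree X (wordDegree (orderedWord T L)) := by
  rw [← toModel_tmul_prod_upperSum, wordDegree_orderedWord]
  refine Submodule.mem_map_of_mem (f := (toModel X).toLinearMap) ?_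
  refine Submodule.mem_iSup_of_mem L.length (Submodule.mem_iSup_of_mem T.length
    (Submodule.mem_iSup_of_mem (add_comm _ _) (Submodule.apply_mem_map₂ _ ?_ ?_)))
  · rw [homogeneousSubmodule_eq_span_pow]
    exact list_prod_mem_span_range_pow _ L
  · rw [exteriorPower_eq_span_pow]
    exact list_prod_mem_span_range_pow _ T

theorem modelDegree_le {r : ℕ} {N : Submodule ℚ (Model X)}
    (hN : ∀ l : List (Bool × X), wordDegree l = r → wordProd l ∈ N) : modelDegree X r ≤ N := by
  rw [modelDegree, Submodule.map_le_iff_le_comap, tensorDegree]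
  refine iSup_le fun i => iSup_le fun j => iSup_le fun hij => ?_
  rw [homogeneousSubmodule_eq_span_pow, exteriorPower_eq_span_pow, Submodule.span_pow,
    Submodule.span_pow, Submodule.map₂_span_span, Submodule.span_le]
  rintro _ ⟨p, hp, x, hx, rfl⟩
  obtain ⟨L, hL, rfl⟩ := exists_list_of_mem_pow hp
  obtain ⟨T, hT, rfl⟩ := exists_list_of_mem_pow hx
  have hdegree : wordDegree (orderedWord T L) = r := by
    rw [wordDegree_orderedWord, hL, hT, add_comm, hij]
  have hmem := hN _ hdegree
  rwa [← toModel_tmul_prod_upperSum] at hmem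

theorem mu_mem_modelDegree {r : ℕ} (t : BasicIndex X r) : mu t.S t.T t.m ∈ modelDegree X r := by
  have hmem := wordProd_orderedWord_mem_modelDegree t.T (expo t.S t.m).toList
  rwa [wordProd_orderedWord, wordDegree_orderedWord, Multiset.length_toList, Multiset.coe_toList,
    card_expo, t.degree, ← mu_eq] at hmem

theorem span_range_mu [FiniteDimensional ℂ V] (hsup : SupClosed (X : Set (Submodule ℂ V)))
    (r : ℕ) :
    Submodule.span ℚ (Set.range fun t : BasicIndex X r => mu t.S t.T t.m) = modelDegree X r :=
  le_antisymm (Submodule.span_le.2 (Set.range_subset_iff.2 mu_mem_modelDegree))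
    (modelDegree_le fun _ => wordProd_mem_span_mu hsup)

end Degree

section Sums

variable {V : Type*} [AddCommGroup V] [Module ℂ V] {𝒜 : Finset (Submodule ℂ V)}

theorem mem_sums {A : Submodule ℂ V} :
    A ∈ sums 𝒜 ↔ ∃ F ⊆ 𝒜, F.Nonempty ∧ F.sup id = A := by
  simp only [sums, Finset.mem_image, Finset.mem_filter, Finset.mem_powerset, and_assoc]

theorem supClosed_sums : SupClosed (sums 𝒜 : Set (Submodule ℂ V)) := by
  classical
  intro A hA B hB
  obtain ⟨F, hF, hne, rfl⟩ := mem_sums.1 hA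
  obtain ⟨G, hG, -, rfl⟩ := mem_sums.1 hB
  exact mem_sums.2
    ⟨F ∪ G, Finset.union_subset hF hG, hne.mono Finset.subset_union_left, Finset.sup_union⟩

theorem ne_bot_of_mem_sums (h𝒜 : ∀ A ∈ 𝒜, A ≠ ⊥) : ∀ A ∈ sums 𝒜, A ≠ ⊥ := by
  intro A hA
  obtain ⟨F, hF, ⟨B, hB⟩, rfl⟩ := mem_sums.1 hA
  exact ne_bot_of_le_ne_bot (h𝒜 B (hF hB)) (Finset.le_sup (f := id) hB)

end Sums

end SubspaceModel

end

theorem proposition3p1 {V : Type*} [AddCommGroup V] [Module ℂ V] [FiniteDimensional ℂ V]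
    (𝒜 : Finset (Submodule ℂ V)) (h𝒜 : ∀ A ∈ 𝒜, A ≠ ⊥) (r : ℕ) :
    ∃ b : Module.Basis (SubspaceModel.BasicIndex (SubspaceModel.sums 𝒜) r) ℚ
        (SubspaceModel.modelDegree (SubspaceModel.sums 𝒜) r),
      ∀ t, (b t : SubspaceModel.Model (SubspaceModel.sums 𝒜)) =
        SubspaceModel.mu t.S t.T t.m := by
  have hspan := SubspaceModel.span_range_mu (SubspaceModel.supClosed_sums (𝒜 := 𝒜)) r
  have hli := SubspaceModel.linearIndependent_mu (SubspaceModel.ne_bot_of_mem_sums h𝒜)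
    SubspaceModel.supClosed_sums r
  refine ⟨(Module.Basis.span hli).map (LinearEquiv.ofEq _ _ hspan), fun t => ?_⟩
  rw [Module.Basis.map_apply, LinearEquiv.coe_ofEq_apply, Module.Basis.span_apply]
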